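/- **Setting.** Let $n,p,m_1,\dots,m_n$ be positive integers. For $i\in[n]$ and $t\in\mathbb N_+$ let $f_{i,t}:\mathbb X\to\mathbb R$ and $g_{i,t}:\mathbb X\to\mathbb R^{m_i}$ be given (deterministic) functions, where $\mathbb X\subseteq\mathbb R^p$, and put $f_t=\frac1n\sum_{j=1}^n f_{j,t}$ and $g_t=\mathrm{col}(g_{1,t},\dots,g_{n,t})$. Vector inequalities are componentwise, $\|\cdot\|$ is the Euclidean norm (the induced operator norm for matrices), $[\cdot]_+$ is the componentwise positive part, and $\mathcal P_K$ is the Euclidean projection onto $K$. Assume: 1. $\mathbb X$ is closed and convex and $r\mathbb B^p\subseteq\mathbb X\subseteq R\,\mathbb B^p$ with $r>0$, where $\mathbb B^p$ is the closed unit ball. 2. $|f_{i,t}(x)|\le F$ for all $i,t$ and $x\in\mathbb X$. 3. All $f_{i,t}$ and all components of $g_{i,t}$ are convex, and at each $x\in\mathbb X$ they have subgradients $\partial f_{i,t}(x)\in\mathbb R^p$ with $\|\partial f_{i,t}(x)\|\le G_1$ and $\partial g_{i,t}(x)\in\mathbb R^{m_i\times p}$ (row by row) with $\|\partial g_{i,t}(x)\|\le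 G_2$. 4. For $t\in\mathbb N_+$ let $\mathcal E_t\subseteq[n]\times[n]$ be the edge set of a directed graph and $W_t\in\mathbb R^{n\times n}$ a doubly stochastic matrix. There are $w\in(0,1)$ and an integer $B>0$ such that for all $t$: $[W_t]_{ij}\ge w$ if $(j,i)\in\mathcal E_t$ or $i=j$, and $[W_t]_{ij}=0$ otherwise; and the graph $([n],\bigcup_{l=0}^{B-1}\mathcal E_{t+l})$ is strongly connected. 5. (Slater's condition) There are $x_s\in\mathbb X$ and $\varsigma_s>0$ with $g_t(x_s)\le-\varsigma_s\mathbf 1$ for all $t\in\mathbb N_+$. **Algorithm.** Let $c\in(0,1)$, let $\gamma_0>0$ satisfy $4(p^2+1)G_2^2\gamma_0\le1$, and put $$\alpha_t=t^{-c},\qquad \gamma_t=\gamma_0/\alpha_t,\qquad \xi_t=\alpha_t,\qquad \delta_t=r\,\alpha_t .$$ Let $u_{i,t}$ ($i\in[n]$, $t\in\mathbb N_+$) be independent random vectors, uniformly distributed on the unit sphere of $\mathbb R^p$. Start from $z_{i,1}\in(1-\xi_1)\mathbb X$ (that is, $z_{i,1}=0$), and for $t=1,2,\dots$ and $i\in[n]$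 set $$x_{i,t}=\sum_{j=1}^n[W_t]_{ij}z_{j,t},\qquad q_{i,t+1}=\gamma_t[g_{i,t}(x_{i,t})]_+,$$ $$\hat\omega_{i,t+1}=\frac p{\delta_t}\bigl(f_{i,t}(x_{i,t}+\delta_tu_{i,t})-f_{i,t}(x_{i,t})\bigr)u_{i,t}+\frac p{\delta_t}\,u_{i,t}\bigl(g_{i,t}(x_{i,t}+\delta_tu_{i,t})-g_{i,t}(x_{i,t})\bigr)^{\!\top}q_{i,t+1},$$ $$z_{i,t+1}=\mathcal P_{(1-\xi_{t+1})\mathbb X}\bigl(x_{i,t}-\alpha_t\hat\omega_{i,t+1}\bigr).$$ **Performance.** Let $\mathcal X_T=\{x\in\mathbb X: g_t(x)\le0\ \ \forall t\in[T]\}$ and $$\mathrm{Net\text{-}Reg}(T)=\frac1n\sum_{i=1}^n\Bigl(\sum_{t=1}^Tf_t(x_{i,t})-\min_{x\in\mathcal X_T}\sum_{t=1}^Tf_t(x)\Bigr),\qquad \mathrm{Net\text{-}CCV}(T)=\frac1n\sum_{i=1}^n\sum_{t=1}^T\bigl\|[g_t(x_{i,t})]_+\bigr\| .$$ **Theorem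 2.** For every $T\in\mathbb N_+$ the minimum is attained, $\mathrm{Net\text{-}Reg}(T)$ and $\mathrm{Net\text{-}CCV}(T)$ are integrable, and $$\mathbf E[\mathrm{Net\text{-}Reg}(T)]\le C_1T^{\max\{c,1-c\}},\qquad \mathbf E[\mathrm{Net\text{-}CCV}(T)]\le C_2T^{1-c},$$ where $C_1$ depends only on $n,p,r,R,G_1,G_2,w,B,c,\gamma_0$, and $C_2$ depends only on these and on $F,\varsigma_s$. -/

import Mathlib

open MeasureTheory ProbabilityTheory
open scoped Pointwise

namespace DistBandit

/-- Euclidean space `ℝᵈ` with the Euclidean norm. -/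
abbrev Euc (d : ℕ) : Type := EuclideanSpace ℝ (Fin d)

/-- The unit sphere `𝕊ᵖ` of `ℝᵖ`. -/
abbrev UnitSphere (p : ℕ) : Type := Metric.sphere (0 : Euc p) 1

/-- The uniform distribution on the unit sphere: normalized surface measure. -/
noncomputable def uniformSphere (p : ℕ) : Measure (UnitSphere p) :=
  ((volume : Measure (Euc p)).toSphere Set.univ)⁻¹ • (volume : Measure (Euc p)).toSphere

/-- The projection `𝒫_K(x) = argmin_{y ∈ K} ‖x - y‖`. -/
noncomputable def metricProj {d : ℕ} (K : Set (Euc d)) (x : Euc d) : Euc d :=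
  Classical.epsilon fun y => y ∈ K ∧ ∀ z ∈ K, ‖x - y‖ ≤ ‖x - z‖

/-- On a nonempty closed convex set the projection is a point of the set at minimal distance. -/
theorem metricProj_spec {d : ℕ} {K : Set (Euc d)} (hne : K.Nonempty) (hcl : IsClosed K)
    (hcv : Convex ℝ K) (x : Euc d) :
    metricProj K x ∈ K ∧ ∀ z ∈ K, ‖x - metricProj K x‖ ≤ ‖x - z‖ := by
  have h : ∃ y, y ∈ K ∧ ∀ z ∈ K, ‖x - y‖ ≤ ‖x - z‖ := by
    obtain ⟨y, hy, hmin⟩ := exists_norm_eq_iInf_of_complete_convex hne hcl.isComplete hcv x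
    refine ⟨y, hy, fun z hz => ?_⟩
    rw [hmin]
    exact ciInf_le ⟨0, by rintro _ ⟨w, rfl⟩; exact norm_nonneg _⟩ (⟨z, hz⟩ : K)
  exact Classical.epsilon_spec h

/-- The componentwise positive part `[v]₊`, the projection of `v` onto the nonnegative orthant. -/
noncomputable def clip {ι : Type} [Fintype ι] (v : EuclideanSpace ℝ ι) : EuclideanSpace ℝ ι :=
  WithLp.toLp 2 fun k => max (v k) 0

/-- The data of a distributed online problem with `n` agents and decisions in `ℝᵖ`.  Time runs
over the positive integers; values at time `0`, and values of `f`, `g` outside `X`, play no role. -/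
structure Problem (n p : ℕ) where
  /-- the decision set -/
  X : Set (Euc p)
  /-- number of constraints of each agent -/
  m : Fin n → ℕ
  /-- local loss functions `f_{i,t}` -/
  f : Fin n → ℕ → Euc p → ℝ
  /-- local constraint functions `g_{i,t}` -/
  g : (i : Fin n) → ℕ → Euc p → Euc (m i)
  /-- edge sets; `(j, i) ∈ edges t` means that `i` receives information from `j` at time `t` -/
  edges : ℕ → Set (Fin n × Fin n)
  /-- mixing matrices -/
  W : ℕ → Matrix (Fin n) (Fin n) ℝ

namespace Problem

variable {n p : ℕ}

/-- The global loss `f_t = (1/n) ∑ⱼ f_{j,t}`. -/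
noncomputable def globalLoss (M : Problem n p) (t : ℕ) (x : Euc p) : ℝ :=
  (1 / (n : ℝ)) * ∑ j, M.f j t x

/-- The global constraint function `g_t = col(g_{1,t}, …, g_{n,t})`. -/
noncomputable def globalConstraint (M : Problem n p) (t : ℕ) (x : Euc p) :
    EuclideanSpace ℝ (Σ i : Fin n, Fin (M.m i)) :=
  WithLp.toLp 2 fun k => M.g k.1 t x k.2

/-- The feasible set `𝒳_T = {x ∈ X : g_t(x) ≤ 0 for all t ∈ [T]}`. -/
def feasibleSet (M : Problem n p) (T : ℕ) : Set (Euc p) :=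
  {x | x ∈ M.X ∧ ∀ t ∈ Finset.Icc 1 T, ∀ k, M.globalConstraint t x k ≤ 0}

/-- `min_{x ∈ 𝒳_T} ∑_{t=1}^T f_t(x)`, written as an infimum. -/
noncomputable def offlineOpt (M : Problem n p) (T : ℕ) : ℝ :=
  sInf ((fun x => ∑ t ∈ Finset.Icc 1 T, M.globalLoss t x) '' M.feasibleSet T)

/-- Network regret of decisions `x_{i,t} = x t i`. -/
noncomputable def netReg (M : Problem n p) (x : ℕ → Fin n → Euc p) (T : ℕ) : ℝ :=
  (1 / (n : ℝ)) * ∑ i, (∑ t ∈ Finset.Icc 1 T, M.globalLoss t (x t i) - M.offlineOpt T)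

/-- Network cumulative constraint violation of decisions `x_{i,t} = x t i`. -/
noncomputable def netCCV (M : Problem n p) (x : ℕ → Fin n → Euc p) (T : ℕ) : ℝ :=
  (1 / (n : ℝ)) * ∑ i, ∑ t ∈ Finset.Icc 1 T, ‖clip (M.globalConstraint t (x t i))‖

/-- The decision set is closed, convex, and lies between the balls of radius `r` and `R`. -/
structure SetAssumption (M : Problem n p) (r R : ℝ) : Prop where
  closed : IsClosed M.X
  convex : Convex ℝ M.X
  inner : Metric.closedBall 0 r ⊆ M.X
  outer : M.X ⊆ Metric.closedBall 0 R

/-- The local losses are uniformly bounded by `F` on the decision set. -/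
def LossBounded (M : Problem n p) (F : ℝ) : Prop :=
  ∀ i t, 1 ≤ t → ∀ x ∈ M.X, |M.f i t x| ≤ F

/-- The local losses and constraint functions are convex on `X`, and at every point of `X` they
have a subgradient of norm at most `G₁`, respectively `G₂`.  A subgradient of the vector-valued
`g_{i,t}` is a linear map whose components are subgradients of the components of `g_{i,t}`.
(Not every subgradient relative to `X` can be bounded: at a boundary point of `X` normal vectors
may be added.) -/
structure ConvexAssumption (M : Problem n p) (G₁ G₂ : ℝ) : Prop where
  convex_f : ∀ i t, 1 ≤ t → ConvexOn ℝ M.X (M.f i t)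
  convex_g : ∀ i t, 1 ≤ t → ∀ k, ConvexOn ℝ M.X fun x => M.g i t x k
  subgrad_f : ∀ i t, 1 ≤ t → ∀ x ∈ M.X, ∃ v : Euc p, ‖v‖ ≤ G₁ ∧
    ∀ y ∈ M.X, M.f i t x + inner ℝ v (y - x) ≤ M.f i t y
  subgrad_g : ∀ i t, 1 ≤ t → ∀ x ∈ M.X, ∃ D : Euc p →L[ℝ] Euc (M.m i), ‖D‖ ≤ G₂ ∧
    ∀ y ∈ M.X, ∀ k, M.g i t x k + D (y - x) k ≤ M.g i t y k

/-- The network assumption: mixing weights adapted to the graph and bounded below by `w`, doubly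
stochastic mixing matrices, and strong connectivity of the union of the edge sets over every
window of length `B`. -/
structure NetworkAssumption (M : Problem n p) (w : ℝ) (B : ℕ) : Prop where
  weight_ge : ∀ t, 1 ≤ t → ∀ i j, (j, i) ∈ M.edges t ∨ i = j → w ≤ M.W t i j
  weight_zero : ∀ t, 1 ≤ t → ∀ i j, ¬((j, i) ∈ M.edges t ∨ i = j) → M.W t i j = 0
  doubly_stochastic : ∀ t, 1 ≤ t → M.W t ∈ doublyStochastic ℝ (Fin n)
  connected : ∀ t, 1 ≤ t → ∀ i j : Fin n,
    Relation.ReflTransGen (fun a b => (a, b) ∈ ⋃ l ∈ Finset.range B, M.edges (t + l)) i j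

/-- Slater's condition with constant `ς`. -/
def Slater (M : Problem n p) (ς : ℝ) : Prop :=
  ∃ xs ∈ M.X, ∀ t, 1 ≤ t → ∀ k, M.globalConstraint t xs k ≤ -ς

end Problem

/-- The parameter sequences of the algorithm. -/
structure Params where
  α : ℕ → ℝ
  γ : ℕ → ℝ
  ξ : ℕ → ℝ
  δ : ℕ → ℝ

/-- The choice `α_t = t^{-c}`, `γ_t = γ₀ / α_t`, `ξ_t = α_t`, `δ_t = r α_t`. -/
noncomputable def powerParams (c γ₀ r : ℝ) : Params where
  α t := 1 / (t : ℝ) ^ c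
  γ t := γ₀ / (1 / (t : ℝ) ^ c)
  ξ t := 1 / (t : ℝ) ^ c
  δ t := r * (1 / (t : ℝ) ^ c)

/-- Two-point estimator `(p/δ) (f(x + δu) - f(x)) u` of the subgradient of a scalar function. -/
noncomputable def gradEst {p : ℕ} (f : Euc p → ℝ) (δ : ℝ) (x u : Euc p) : Euc p :=
  ((p : ℝ) / δ * (f (x + δ • u) - f x)) • u

/-- Two-point estimator `(p/δ) (g(x + δu) - g(x))ᵀ ⊗ u`, a `p × m` matrix, of the subgradient of
a vector-valued function. -/
noncomputable def jacEst {p m : ℕ} (g : Euc p → Euc m) (δ : ℝ) (x u : Euc p) :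
    Matrix (Fin p) (Fin m) ℝ :=
  ((p : ℝ) / δ) • Matrix.vecMulVec (fun a => u a) (fun k => (g (x + δ • u) - g x) k)

namespace Problem

variable {n p : ℕ}

/-- The consensus step `x_{i,t} = ∑ⱼ [W_t]ᵢⱼ z_{j,t}`. -/
noncomputable def mix (M : Problem n p) (t : ℕ) (z : Fin n → Euc p) (i : Fin n) : Euc p :=
  ∑ j, M.W t i j • z j

/-- The dual update `q_{i,t+1} = γ_t [g_{i,t}(x)]₊`. -/
noncomputable def dual (M : Problem n p) (a : Params) (t : ℕ) (i : Fin n) (x : Euc p) :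
    Euc (M.m i) :=
  a.γ t • clip (M.g i t x)

/-- The direction `ω̂_{i,t+1} = ∂̂f_{i,t}(x) + ∂̂g_{i,t}(x) q_{i,t+1}`, with exploration
direction `u`. -/
noncomputable def direction (M : Problem n p) (a : Params) (t : ℕ) (i : Fin n) (x u : Euc p) :
    Euc p :=
  gradEst (M.f i t) (a.δ t) x u +
    WithLp.toLp 2 ((jacEst (M.g i t) (a.δ t) x u).mulVec fun k => M.dual a t i x k)

/-- One iteration `z_t ↦ z_{t+1}`:
`z_{i,t+1} = 𝒫_{(1-ξ_{t+1})X}(x_{i,t} - α_t ω̂_{i,t+1})`. -/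
noncomputable def step (M : Problem n p) (a : Params) (t : ℕ) (u : Fin n → UnitSphere p)
    (z : Fin n → Euc p) (i : Fin n) : Euc p :=
  metricProj ((1 - a.ξ (t + 1)) • M.X)
    (M.mix t z i - a.α t • M.direction a t i (M.mix t z i) (u i))

/-- The iterates `z_t = (z_{i,t})ᵢ`, `t ≥ 1`, started at `z_1 = z₁`, for exploration directions
`u_{i,t} = u t i` (the value at `t = 0` is a placeholder). -/
noncomputable def zIter (M : Problem n p) (a : Params) (z₁ : Fin n → Euc p)
    (u : ℕ → Fin n → UnitSphere p) : ℕ → Fin n → Euc p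
  | 0 => z₁
  | 1 => z₁
  | t + 2 => M.step a (t + 1) (u (t + 1)) (M.zIter a z₁ u (t + 1))

/-- The decisions `x_{i,t}` generated by the algorithm. -/
noncomputable def xIter (M : Problem n p) (a : Params) (z₁ : Fin n → Euc p)
    (u : ℕ → Fin n → UnitSphere p) (t : ℕ) : Fin n → Euc p :=
  M.mix t (M.zIter a z₁ u t)

end Problem

/-- `U t i`, `t ≥ 1`, are independent random vectors, uniformly distributed on the unit sphere. -/
structure IsExploration {Ω : Type*} [MeasurableSpace Ω] {n p : ℕ} (P : Measure Ω)
    (U : ℕ → Fin n → Ω → UnitSphere p) : Prop where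
  measurable : ∀ t, 1 ≤ t → ∀ i, Measurable (U t i)
  law : ∀ t, 1 ≤ t → ∀ i, P.map (U t i) = uniformSphere p
  indep : iIndepFun (fun k : ℕ+ × Fin n => U k.1 k.2) P

end DistBandit

open DistBandit

/-! Each agent performs projected descent on its Lagrangian `f + ⟨q, g⟩` with multiplier `q = γ_t
[g(x)]₊`. The two-point estimators of `f` and `g` share one random direction, so together they form
a single scalar estimator of this Lagrangian with `q` frozen (`direction_eq`).

The estimator is an approximate subgradient in the mean. For convex Lipschitz `h`, integration by
parts on the unit ball turns the spherical mean of `⟨estimator, x - y⟩` into a mean of directional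
derivatives, and convexity bounds that mean below by `h x - h y - 2Λδ` (`gradEst_lower_bound`). No
smoothed function has to be differentiated. The pathwise defect in this inequality is `noise`. Its
mean is nonpositive because `x_{i,t}` depends on earlier directions only (`integral_noise_nonpos`).

Up to this noise everything is deterministic. Projection and averaging give an inequality for one
step (`one_step`, `sum_one_step`). The smallness of `γ₀` lets the penalty `γ_t ‖[g(x)]₊‖²` dominate
the quadratic part of the squared estimator norm and leaves the fraction `1/(p²+1)` of the penalty.
That remainder absorbs terms linear in the violation at a cost `O(α_t)`.

Disagreement between agents is controlled because products of `nB` mixing matrices have all entries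
at least `w^(nB)` and contract the spread. The cumulative spread is therefore at most a constant
times the cumulative projection displacement (`sum_spread_le`).

Comparison with the offline optimum gives the regret bound: the weighted telescope costs `T^c` and
the errors `∑ α_t` cost `T^(1-c)` (`regret_path_le`). Comparison with the Slater point, after
multiplication by `α_t`, gives an unweighted telescope and the linear gain `ςγ₀‖[g(x)]₊‖`, hence the
violation bound (`ccv_path_le`). -/

namespace DistBandit
open Set Filter Topology

/-! ### Polar coordinates, thin shells and the radial cutoff. -/

/-- Polar coordinates for functions of product form. -/
theorem integral_polar {E : Type*} [NormedAddCommGroup E] [NormedSpace ℝ E] [MeasurableSpace E]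
    [BorelSpace E] [FiniteDimensional ℝ E] [Nontrivial E] (μ : Measure E) [μ.IsAddHaarMeasure]
    (φ : E → ℝ) (v : ℝ → ℝ) :
    ∫ z, φ (‖z‖⁻¹ • z) * v ‖z‖ ∂μ =
      (∫ u : Metric.sphere (0 : E) 1, φ u ∂μ.toSphere) *
        ∫ ρ : Ioi (0 : ℝ), v ρ ∂Measure.volumeIoiPow (Module.finrank ℝ E - 1) := by
  have h1 : ∫ z, φ (‖z‖⁻¹ • z) * v ‖z‖ ∂μ =
      ∫ z : ({(0)}ᶜ : Set E), φ (‖z.1‖⁻¹ • z.1) * v ‖z.1‖ ∂(μ.comap (↑)) := by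
    rw [integral_subtype_comap (measurableSet_singleton _).compl
      (fun z : E => φ (‖z‖⁻¹ • z) * v ‖z‖), restrict_compl_singleton]
  rw [h1, ← integral_prod_mul (fun u : Metric.sphere (0 : E) 1 => φ u) (fun ρ : Ioi (0 : ℝ) => v ρ),
    ← μ.measurePreserving_homeomorphUnitSphereProd.integral_comp
        (Homeomorph.measurableEmbedding _)]
  simp

theorem integral_volumeIoiPow_shell {d : ℕ} (hd : 0 < d) {ε : ℝ} (h0 : 0 < ε) (h1 : ε < 1) :
    ∫ ρ : Ioi (0 : ℝ), (Ico (1 - ε) 1).indicator (fun _ => (1 : ℝ)) (ρ : ℝ)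
      ∂Measure.volumeIoiPow (d - 1) = (1 - (1 - ε) ^ d) / d := by
  have hE : ∀ ρ : Ioi (0 : ℝ), (Ico (1 - ε) 1).indicator (fun _ => (1 : ℝ)) (ρ : ℝ) =
      (Iio (⟨1, mem_Ioi.2 one_pos⟩ : Ioi (0 : ℝ)) \ Iio ⟨1 - ε, by simpa using h1⟩).indicator
        1 ρ := by
    intro ρ
    have : (ρ : ℝ) ∈ Ico (1 - ε) 1 ↔
        ρ ∈ Iio (⟨1, mem_Ioi.2 one_pos⟩ : Ioi (0 : ℝ)) \ Iio ⟨1 - ε, by simpa using h1⟩ := by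
      rw [Set.mem_sdiff, mem_Iio, mem_Iio, not_lt, ← Subtype.coe_le_coe, ← Subtype.coe_lt_coe,
        mem_Ico, and_comm]
    by_cases h : (ρ : ℝ) ∈ Ico (1 - ε) 1
    · rw [indicator_of_mem h, indicator_of_mem (this.1 h), Pi.one_apply]
    · rw [indicator_of_notMem h, indicator_of_notMem (fun h' => h (this.2 h'))]
  simp_rw [hE]
  rw [integral_indicator_one (measurableSet_Iio.diff measurableSet_Iio),
    measureReal_sdiff _ measurableSet_Iio (by simp [Measure.volumeIoiPow_apply_Iio])]
  · have hd' : d - 1 + 1 = d := Nat.sub_add_cancel hd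
    have hd2 : ((d - 1 : ℕ) : ℝ) + 1 = d := by exact_mod_cast hd'
    simp only [Measure.real, Measure.volumeIoiPow_apply_Iio]
    rw [ENNReal.toReal_ofReal, ENNReal.toReal_ofReal, hd', hd2]
    · simp; ring
    · have : 0 ≤ 1 - ε := by linarith
      positivity
    · positivity
  · exact Iio_subset_Iio (by rw [← Subtype.coe_le_coe]; simp; linarith)

theorem hasDerivAt_norm_line {E : Type*} [NormedAddCommGroup E] [InnerProductSpace ℝ E]
    {z : E} (hz : z ≠ 0) (h : E) :
    HasDerivAt (fun s : ℝ => ‖z + s • h‖) (inner ℝ (‖z‖⁻¹ • z) h) 0 := by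
  have h1 : HasDerivAt (fun s : ℝ => z + s • h) h 0 := by
    simpa using ((hasDerivAt_id (0 : ℝ)).smul_const h).const_add z
  have h2 := h1.norm_sq
  have h3 := h2.sqrt (by simpa using hz)
  simp only [Real.sqrt_sq (norm_nonneg _)] at h3
  convert h3 using 1
  simp [inner_smul_left]
  field_simp

/-- The radial cutoff, `1` on the ball of radius `1 - ε` and `0` off the unit ball. -/
noncomputable def cutoff {E : Type*} [Norm E] (ε : ℝ) (z : E) : ℝ :=
  max 0 (min 1 ((1 - ‖z‖) * ε⁻¹))

section cutoff
variable {E : Type*} [NormedAddCommGroup E] {ε : ℝ}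

theorem cutoff_nonneg (z : E) : 0 ≤ cutoff ε z := le_max_left _ _

theorem cutoff_le_one (z : E) : cutoff ε z ≤ 1 := by simp [cutoff]

theorem cutoff_eq_zero (hε : 0 < ε) {z : E} (hz : 1 ≤ ‖z‖) : cutoff ε z = 0 := by
  have : (1 - ‖z‖) * ε⁻¹ ≤ 0 := mul_nonpos_of_nonpos_of_nonneg (by linarith) (by positivity)
  simp [cutoff, this]

theorem cutoff_eq_one (hε : 0 < ε) {z : E} (hz : ‖z‖ ≤ 1 - ε) : cutoff ε z = 1 := by
  have : 1 ≤ (1 - ‖z‖) * ε⁻¹ := by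
    rw [← div_eq_mul_inv, one_le_div hε]; linarith
  simp [cutoff, this]

theorem cutoff_eq_mul (hε : 0 < ε) {z : E} (h1 : 1 - ε ≤ ‖z‖) (h2 : ‖z‖ ≤ 1) :
    cutoff ε z = (1 - ‖z‖) * ε⁻¹ := by
  have h3 : (1 - ‖z‖) * ε⁻¹ ≤ 1 := by
    rw [← div_eq_mul_inv, div_le_one hε]; linarith
  have h4 : 0 ≤ (1 - ‖z‖) * ε⁻¹ := mul_nonneg (by linarith) (by positivity)
  simp [cutoff, h3, h4]

theorem lipschitzWith_cutoff (hε : 0 < ε) :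
    LipschitzWith (Real.toNNReal ε⁻¹) (cutoff ε : E → ℝ) := by
  have h1 : LipschitzWith (Real.toNNReal ε⁻¹) (fun z : E => (1 - ‖z‖) * ε⁻¹) := by
    refine LipschitzWith.of_dist_le_mul fun x y => ?_
    rw [Real.dist_eq, Real.coe_toNNReal _ (by positivity), ← sub_mul, abs_mul,
      abs_of_pos (inv_pos.2 hε), mul_comm, dist_eq_norm]
    refine mul_le_mul_of_nonneg_left ?_ (by positivity)
    rw [show 1 - ‖x‖ - (1 - ‖y‖) = -(‖x‖ - ‖y‖) by ring, abs_neg]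
    exact abs_norm_sub_norm_le x y
  exact (h1.const_min 1).const_max 0

theorem hasCompactSupport_cutoff [ProperSpace E] (hε : 0 < ε) :
    HasCompactSupport (cutoff ε : E → ℝ) := by
  refine HasCompactSupport.intro (isCompact_closedBall (0 : E) 1) fun z hz => ?_
  simp only [Metric.mem_closedBall, dist_zero_right, not_le] at hz
  exact cutoff_eq_zero hε hz.le

/-- Away from two null spheres the cutoff is locally constant or affine in the norm. Its gradient is
the inward radial unit vector times `ε⁻¹` on the shell, which approximates surface measure on the
sphere as `ε → 0`. -/
theorem lineDeriv_cutoff [InnerProductSpace ℝ E] (hε : 0 < ε) (hε1 : ε < 1) {z : E} (hz1 : ‖z‖ ≠ 1)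
    (hz2 : ‖z‖ ≠ 1 - ε) (h : E) :
    lineDeriv ℝ (cutoff ε) z h =
      -(ε⁻¹ * (Ico (1 - ε) 1).indicator (fun _ => (1 : ℝ)) ‖z‖ * inner ℝ (‖z‖⁻¹ • z) h) := by
  have hcont : ContinuousAt (fun s : ℝ => ‖z + s • h‖) 0 := by fun_prop
  have h0 : ‖z + (0 : ℝ) • h‖ = ‖z‖ := by simp
  have hlt : ∀ a, ‖z‖ < a → ∀ᶠ s : ℝ in 𝓝 0, ‖z + s • h‖ < a := fun a ha =>
    hcont.eventually_lt continuousAt_const (by simpa using ha)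
  have hgt : ∀ a, a < ‖z‖ → ∀ᶠ s : ℝ in 𝓝 0, a < ‖z + s • h‖ := fun a ha =>
    continuousAt_const.eventually_lt hcont (by simpa using ha)
  unfold lineDeriv
  rcases lt_or_gt_of_ne hz2 with h2 | h2
  · rw [indicator_of_notMem (fun hm => absurd hm.1 (not_le.2 h2))]
    have : (fun s : ℝ => cutoff ε (z + s • h)) =ᶠ[𝓝 0] fun _ => (1 : ℝ) := by
      filter_upwards [hlt _ h2] with s hs using cutoff_eq_one hε hs.le
    rw [this.deriv_eq]; simp
  rcases lt_or_gt_of_ne hz1 with h1 | h1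
  · rw [indicator_of_mem (Set.mem_Ico.2 ⟨h2.le, h1⟩)]
    have : (fun s : ℝ => cutoff ε (z + s • h)) =ᶠ[𝓝 0] fun s => (1 - ‖z + s • h‖) * ε⁻¹ := by
      filter_upwards [hlt _ h1, hgt _ h2] with s hs hs' using cutoff_eq_mul hε hs'.le hs.le
    rw [this.deriv_eq]
    have hz : z ≠ 0 := by
      rintro rfl
      simp at h2; linarith
    rw [(((hasDerivAt_norm_line hz h).const_sub 1).mul_const ε⁻¹).deriv]
    ring
  · rw [indicator_of_notMem (fun hm => absurd hm.2 (not_lt.2 h1.le))]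
    have : (fun s : ℝ => cutoff ε (z + s • h)) =ᶠ[𝓝 0] fun _ => (0 : ℝ) := by
      filter_upwards [hgt _ h1] with s hs using cutoff_eq_zero hε hs.le
    rw [this.deriv_eq]; simp

end cutoff
end DistBandit

namespace DistBandit
open Set Filter Topology

/-! ### A divergence inequality on the unit ball. -/

section smoothing
variable {E : Type*} [NormedAddCommGroup E] [InnerProductSpace ℝ E]

/-- Moving from `z` along `h` instead of towards the point `h` changes the position by `s • z`,
which costs `L`. Convexity bounds the slope towards `h` by `F h - F z`, and replacing `F z` by `F 0`
costs another `L`. -/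
theorem lineDeriv_le_of_segment {F : E → ℝ} {L : NNReal} (hF : LipschitzWith L F) {z h : E}
    (hz : ‖z‖ ≤ 1)
    (hconv : ∀ s ∈ Ioo (0 : ℝ) 1, F (z + s • (h - z)) ≤ F z + s * (F h - F z))
    (hd : LineDifferentiableAt ℝ F z h) :
    lineDeriv ℝ F z h ≤ F h - F 0 + 2 * L := by
  have h1 := hd.hasLineDerivAt.tendsto_slope_zero_right
  refine le_of_tendsto h1 ?_
  filter_upwards [Ioo_mem_nhdsGT (zero_lt_one' ℝ)] with s hs
  have h2 : F (z + s • h) ≤ F (z + s • (h - z)) + L * s := by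
    have := hF.dist_le_mul (z + s • h) (z + s • (h - z))
    rw [Real.dist_eq, dist_eq_norm,
      show z + s • h - (z + s • (h - z)) = s • z by rw [smul_sub]; abel, norm_smul,
      Real.norm_of_nonneg hs.1.le] at this
    have h4 := (abs_le.1 this).2
    have : (L : ℝ) * (s * ‖z‖) ≤ L * (s * 1) := by have := hs.1; gcongr
    linarith
  have h3 : F 0 ≤ F z + L := by
    have := hF.dist_le_mul 0 z
    rw [Real.dist_eq, dist_zero_left] at this
    have h4 := (abs_le.1 this).2
    have : (L : ℝ) * ‖z‖ ≤ L * 1 := by gcongr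
    linarith
  rw [smul_eq_mul, inv_mul_le_iff₀ hs.1]
  have h5 := hconv s hs
  have h6 : 0 ≤ s * (F z + L - F 0) := mul_nonneg hs.1.le (by linarith)
  nlinarith

variable [FiniteDimensional ℝ E] [MeasurableSpace E] [BorelSpace E]

theorem integral_shell [Nontrivial E] (μ : Measure E) [μ.IsAddHaarMeasure] {ε : ℝ} (h0 : 0 < ε)
    (h1 : ε < 1) (φ : E → ℝ) :
    ∫ z, φ (‖z‖⁻¹ • z) * (Ico (1 - ε) 1).indicator (fun _ => (1 : ℝ)) ‖z‖ ∂μ =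
      (∫ u : Metric.sphere (0 : E) 1, φ u ∂μ.toSphere) *
        ((1 - (1 - ε) ^ Module.finrank ℝ E) / Module.finrank ℝ E) := by
  rw [integral_polar, integral_volumeIoiPow_shell Module.finrank_pos h0 h1]

/-- Divergence inequality on the unit ball for functions that are convex along segments
to `h`, before passing to the limit in the width `ε` of the boundary layer. -/
theorem integral_sphere_mul_inner_le_aux [Nontrivial E] (μ : Measure E) [μ.IsAddHaarMeasure]
    {F : E → ℝ} {L : NNReal} (hF : LipschitzWith L F) (h : E)
    (hconv : ∀ z, ‖z‖ ≤ 1 → ∀ s ∈ Ioo (0 : ℝ) 1, F (z + s • (h - z)) ≤ F z + s * (F h - F z))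
    {ε : ℝ} (h0 : 0 < ε) (h1 : ε < 1) :
    ε⁻¹ * ((∫ u : Metric.sphere (0 : E) 1, F u * inner ℝ (u : E) h ∂μ.toSphere) *
        ((1 - (1 - ε) ^ Module.finrank ℝ E) / Module.finrank ℝ E)) ≤
      μ.real (Metric.ball 0 1) * (F h - F 0 + 2 * L) +
        (|F h - F 0 + 2 * L| + L * ‖h‖) *
          (μ.real (Metric.ball 0 1) * (1 - (1 - ε) ^ Module.finrank ℝ E)) := by
  set K : ℝ := F h - F 0 + 2 * L with hK
  set d := Module.finrank ℝ E with hd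
  have hdpos : (0 : ℝ) < d := by exact_mod_cast Module.finrank_pos
  set sh : E → ℝ := fun z => (Ico (1 - ε) 1).indicator (fun _ => (1 : ℝ)) ‖z‖ with hsh
  have hshB : ∀ z, sh z ≤ (Metric.ball (0 : E) 1).indicator 1 z := by
    intro z
    by_cases hz : ‖z‖ ∈ Ico (1 - ε) 1
    · have : z ∈ Metric.ball (0 : E) 1 := by simpa using hz.2
      simp [hsh, indicator_of_mem hz, indicator_of_mem this]
    · simp only [hsh, indicator_of_notMem hz]
      exact indicator_nonneg (fun _ _ => zero_le_one) _
  have hsh0 : ∀ z, 0 ≤ sh z := fun z => indicator_nonneg (fun _ _ => zero_le_one) _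
  have hshm : Measurable sh :=
    ((measurable_const.indicator measurableSet_Ico).comp measurable_norm)
  have hBint : Integrable ((Metric.ball (0 : E) 1).indicator (1 : E → ℝ)) μ :=
    (integrable_indicator_iff measurableSet_ball).2
      (integrableOn_const (by exact measure_ball_lt_top.ne))
  have hshint : Integrable sh μ := by
    refine hBint.mono' hshm.aestronglyMeasurable (Eventually.of_forall fun z => ?_)
    rw [Real.norm_of_nonneg (hsh0 z)]; exact hshB z
  have hBval : ∫ z, (Metric.ball (0 : E) 1).indicator (1 : E → ℝ) z ∂μ =
      μ.real (Metric.ball 0 1) := integral_indicator_one measurableSet_ball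
  have hshval : ∫ z, sh z ∂μ = μ.real (Metric.ball 0 1) * (1 - (1 - ε) ^ d) := by
    -- The total surface measure is the dimension times the ball volume, which cancels the division
    -- by `d`.
    have := integral_shell μ h0 h1 (fun _ => (1 : ℝ))
    simp only [one_mul, integral_const, smul_eq_mul, mul_one,
      Measure.toSphere_real_apply_univ] at this
    rw [hsh, this, ← hd]; field_simp
  have hkint : Integrable (cutoff ε : E → ℝ) μ :=
    (lipschitzWith_cutoff h0).continuous.integrable_of_hasCompactSupport
      (hasCompactSupport_cutoff h0)
  -- the integral of the cutoff
  have hkK : (∫ z, cutoff ε z ∂μ) * K ≤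
      μ.real (Metric.ball 0 1) * K + |K| * (μ.real (Metric.ball 0 1) * (1 - (1 - ε) ^ d)) := by
    rw [← hshval, ← hBval]
    have h2 : ∫ z, cutoff ε z ∂μ ≤ ∫ z, (Metric.ball (0 : E) 1).indicator (1 : E → ℝ) z ∂μ := by
      refine integral_mono hkint hBint fun z => ?_
      by_cases hz : z ∈ Metric.ball (0 : E) 1
      · rw [indicator_of_mem hz]; exact cutoff_le_one z
      · rw [indicator_of_notMem hz, cutoff_eq_zero h0 (by simpa using hz)]
    have h3 : ∫ z, (Metric.ball (0 : E) 1).indicator (1 : E → ℝ) z ∂μ ≤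
        ∫ z, cutoff ε z ∂μ + ∫ z, sh z ∂μ := by
      rw [← integral_add hkint hshint]
      refine integral_mono hBint (hkint.add hshint) fun z => ?_
      by_cases hz : z ∈ Metric.ball (0 : E) 1
      · rw [indicator_of_mem hz]
        have hz1 : ‖z‖ < 1 := by simpa using hz
        by_cases h4 : ‖z‖ ≤ 1 - ε
        · have := hsh0 z
          simp [cutoff_eq_one h0 h4, this]
        · have : sh z = 1 := indicator_of_mem (Set.mem_Ico.2 ⟨(not_le.1 h4).le, hz1⟩) _
          have h5 := cutoff_nonneg (ε := ε) z
          simp [this, h5]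
      · rw [indicator_of_notMem hz]
        exact add_nonneg (cutoff_nonneg z) (hsh0 z)
    set a := ∫ z, cutoff ε z ∂μ
    set b := ∫ z, (Metric.ball (0 : E) 1).indicator (1 : E → ℝ) z ∂μ
    set e := ∫ z, sh z ∂μ
    -- The sign of `K` is unknown, so the gap between the integral of the cutoff and the ball volume
    -- is bounded in absolute value by the shell mass.
    have h6 : (a - b) * K ≤ |a - b| * |K| := (le_abs_self _).trans (abs_mul _ _).le
    have h7 : |a - b| ≤ e := abs_le.2 ⟨by linarith, by linarith⟩
    have h8 : |a - b| * |K| ≤ e * |K| := by gcongr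
    nlinarith
  -- Integration by parts puts the derivative on the cutoff, where it concentrates on the shell;
  -- compact support removes boundary terms.
  have hIBP := hF.integral_lineDeriv_mul_eq (μ := μ) (lipschitzWith_cutoff (E := E) h0)
    (hasCompactSupport_cutoff h0) h
  -- upper bound of the left hand side
  have hleft : ∫ z, lineDeriv ℝ F z h * cutoff ε z ∂μ ≤ (∫ z, cutoff ε z ∂μ) * K := by
    rw [← integral_mul_const]
    refine integral_mono_ae ?_ (hkint.mul_const K) ?_
    · refine hkint.bdd_mul (c := L * ‖h‖)
        (aestronglyMeasurable_lineDeriv hF.continuous μ) (Eventually.of_forall fun z => ?_)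
      exact norm_lineDeriv_le_of_lipschitz ℝ hF
    · filter_upwards [hF.ae_lineDifferentiableAt (μ := μ) h] with z hz
      rcases le_or_gt ‖z‖ 1 with hz1 | hz1
      · rw [mul_comm]
        exact mul_le_mul_of_nonneg_left (lineDeriv_le_of_segment hF hz1 (hconv z hz1) hz)
          (cutoff_nonneg z)
      · simp [cutoff_eq_zero h0 hz1.le]
  -- lower bound of the right hand side
  have hfc : Continuous F := hF.continuous
  have hnm : Measurable fun z : E => ‖z‖⁻¹ • z := measurable_norm.inv.smul measurable_id
  have hφm : Measurable fun z : E => F (‖z‖⁻¹ • z) * inner ℝ (‖z‖⁻¹ • z) h :=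
    (hfc.measurable.comp hnm).mul (hnm.inner_const)
  have hnle : ∀ z : E, ‖‖z‖⁻¹ • z‖ ≤ 1 := by
    intro z
    rcases eq_or_ne z 0 with rfl | hz
    · simp
    · rw [norm_smul, norm_inv, norm_norm, inv_mul_cancel₀ (norm_ne_zero_iff.2 hz)]
  have hin : ∀ z : E, |inner ℝ (‖z‖⁻¹ • z) h| ≤ ‖h‖ := fun z =>
    (abs_real_inner_le_norm _ _).trans (by
      have := mul_le_mul_of_nonneg_right (hnle z) (norm_nonneg h); simpa using this)
  have hφb : ∀ z : E, |F (‖z‖⁻¹ • z) * inner ℝ (‖z‖⁻¹ • z) h| ≤ (|F 0| + L) * ‖h‖ := by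
    intro z
    rw [abs_mul]
    refine mul_le_mul ?_ (hin z) (abs_nonneg _) (by positivity)
    have := hF.dist_le_mul (‖z‖⁻¹ • z) 0
    rw [Real.dist_eq, dist_zero_right] at this
    have h2 : (L : ℝ) * ‖‖z‖⁻¹ • z‖ ≤ L * 1 := by gcongr; exact hnle z
    have h3 := abs_add_le (F (‖z‖⁻¹ • z) - F 0) (F 0)
    rw [sub_add_cancel] at h3
    linarith
  have hφint : Integrable (fun z => F (‖z‖⁻¹ • z) * inner ℝ (‖z‖⁻¹ • z) h * sh z) μ :=
    hshint.bdd_mul hφm.aestronglyMeasurable (Eventually.of_forall hφb)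
  -- On the shell, `F` differs from its value at the radial projection by at most `Lε`. The factor
  -- `ε⁻¹` makes this a bounded error, integrated over a shell of vanishing mass.
  have hright : ε⁻¹ * ∫ z, F (‖z‖⁻¹ • z) * inner ℝ (‖z‖⁻¹ • z) h * sh z ∂μ -
      L * ‖h‖ * ∫ z, sh z ∂μ ≤ ∫ z, lineDeriv ℝ (cutoff ε) z (-h) * F z ∂μ := by
    rw [← integral_const_mul, ← integral_const_mul, ← integral_sub (hφint.const_mul _)
      (hshint.const_mul _)]
    have hae : ∀ᵐ z ∂μ, ‖z‖ ≠ 1 ∧ ‖z‖ ≠ 1 - ε := by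
      have e1 : ∀ᵐ z ∂μ, z ∉ Metric.sphere (0 : E) 1 :=
        measure_eq_zero_iff_ae_notMem.1 (Measure.addHaar_sphere μ 0 1)
      have e2 : ∀ᵐ z ∂μ, z ∉ Metric.sphere (0 : E) (1 - ε) :=
        measure_eq_zero_iff_ae_notMem.1 (Measure.addHaar_sphere μ 0 (1 - ε))
      filter_upwards [e1, e2] with z hz1 hz2
      exact ⟨by simpa using hz1, by simpa using hz2⟩
    refine integral_mono_ae ((hφint.const_mul _).sub (hshint.const_mul _)) ?_ ?_
    · have hcm : Measurable fun z : E => F z * cutoff ε z :=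
        hfc.measurable.mul (lipschitzWith_cutoff h0).continuous.measurable
      refine ((hshint.const_mul (ε⁻¹ * ((|F 0| + L) * ‖h‖)))).mono'
        ((aestronglyMeasurable_lineDeriv (lipschitzWith_cutoff h0).continuous μ).mul
          hfc.aestronglyMeasurable) ?_
      filter_upwards [hae] with z hz
      rw [lineDeriv_cutoff h0 h1 hz.1 hz.2, inner_neg_right]
      change |_| ≤ ε⁻¹ * ((|F 0| + L) * ‖h‖) * sh z
      by_cases hz3 : ‖z‖ ∈ Ico (1 - ε) 1
      · have e1 : (Ico (1 - ε) 1).indicator (fun _ => (1 : ℝ)) ‖z‖ = 1 := indicator_of_mem hz3 _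
        have e2 : |F z| ≤ |F 0| + L := by
          have := hF.dist_le_mul z 0
          rw [Real.dist_eq, dist_zero_right] at this
          have h2 : (L : ℝ) * ‖z‖ ≤ L * 1 := by gcongr; exact hz3.2.le
          have h3 := abs_add_le (F z - F 0) (F 0)
          rw [sub_add_cancel] at h3
          linarith
        simp only [hsh, e1, mul_one, abs_mul, abs_neg, abs_of_pos (inv_pos.2 h0)]
        rw [mul_assoc, mul_comm |inner ℝ (‖z‖⁻¹ • z) h|]
        have := hin z
        gcongr
      · have e1 : (Ico (1 - ε) 1).indicator (fun _ => (1 : ℝ)) ‖z‖ = 0 := indicator_of_notMem hz3 _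
        simp [hsh, e1]
    · filter_upwards [hae] with z hz
      rw [lineDeriv_cutoff h0 h1 hz.1 hz.2, inner_neg_right]
      by_cases hz3 : ‖z‖ ∈ Ico (1 - ε) 1
      · have e1 : (Ico (1 - ε) 1).indicator (fun _ => (1 : ℝ)) ‖z‖ = 1 := indicator_of_mem hz3 _
        simp only [hsh, e1, mul_one]
        have hzpos : 0 < ‖z‖ := by linarith [hz3.1]
        have e3 : |F (‖z‖⁻¹ • z) - F z| ≤ L * ε := by
          have := hF.dist_le_mul (‖z‖⁻¹ • z) z
          rw [Real.dist_eq, dist_eq_norm] at this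
          refine this.trans ?_
          gcongr
          have e4 : ‖z‖⁻¹ • z - z = (‖z‖⁻¹ - 1) • z := by rw [sub_smul, one_smul]
          have e5 : 0 ≤ ‖z‖⁻¹ - 1 := by
            have := (one_le_inv₀ hzpos).2 hz3.2.le; linarith
          rw [e4, norm_smul, Real.norm_of_nonneg e5, sub_mul, inv_mul_cancel₀ hzpos.ne']
          linarith [hz3.1]
        set a := inner ℝ (‖z‖⁻¹ • z) h
        have e6 : (F (‖z‖⁻¹ • z) - F z) * a ≤ L * ε * ‖h‖ := by
          refine (le_abs_self _).trans ?_
          rw [abs_mul]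
          have := hin z
          gcongr
        have e7 : ε⁻¹ * ((F (‖z‖⁻¹ • z) - F z) * a) ≤ L * ‖h‖ := by
          rw [inv_mul_le_iff₀ h0]; linarith
        linarith
      · have e1 : (Ico (1 - ε) 1).indicator (fun _ => (1 : ℝ)) ‖z‖ = 0 := indicator_of_notMem hz3 _
        simp [hsh, e1]
  have hsph := integral_shell μ h0 h1 (fun z : E => F z * inner ℝ z h)
  rw [hsph, hshval] at hright
  rw [hIBP] at hleft
  linarith

/-- On the unit ball, `∫_𝕊 F(u) ⟨u, h⟩ dσ(u) ≤ vol(𝔹) (F(h) - F(0) + 2L)` for an `L`-Lipschitz `F`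
that is convex along the segments from points of the ball to `h`. -/
theorem integral_sphere_mul_inner_le [Nontrivial E] (μ : Measure E) [μ.IsAddHaarMeasure]
    {F : E → ℝ} {L : NNReal} (hF : LipschitzWith L F) (h : E)
    (hconv : ∀ z, ‖z‖ ≤ 1 → ∀ s ∈ Ioo (0 : ℝ) 1, F (z + s • (h - z)) ≤ F z + s * (F h - F z)) :
    ∫ u : Metric.sphere (0 : E) 1, F u * inner ℝ (u : E) h ∂μ.toSphere ≤
      μ.real (Metric.ball 0 1) * (F h - F 0 + 2 * L) := by
  set A := ∫ u : Metric.sphere (0 : E) 1, F u * inner ℝ (u : E) h ∂μ.toSphere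
  set d := Module.finrank ℝ E with hd
  have hdpos : (0 : ℝ) < d := by exact_mod_cast Module.finrank_pos
  -- The quotient `(1 - (1 - ε)^d) / ε` is written as a geometric sum, so its limit `d` follows by
  -- continuity.
  have hl : Tendsto (fun ε : ℝ => A * ((∑ i ∈ Finset.range d, (1 - ε) ^ i) / d)) (𝓝[>] 0) (𝓝 A) := by
    have hc : Continuous fun ε : ℝ => A * ((∑ i ∈ Finset.range d, (1 - ε) ^ i) / d) := by fun_prop
    have := (hc.tendsto 0).mono_left (nhdsWithin_le_nhds (s := Ioi (0 : ℝ)))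
    simpa [hdpos.ne'] using this
  have hr : Tendsto (fun ε : ℝ => μ.real (Metric.ball 0 1) * (F h - F 0 + 2 * L) +
        (|F h - F 0 + 2 * L| + L * ‖h‖) *
          (μ.real (Metric.ball 0 1) * (1 - (1 - ε) ^ d))) (𝓝[>] 0)
      (𝓝 (μ.real (Metric.ball 0 1) * (F h - F 0 + 2 * L))) := by
    have hc : Continuous fun ε : ℝ => μ.real (Metric.ball (0 : E) 1) * (F h - F 0 + 2 * L) +
        (|F h - F 0 + 2 * L| + L * ‖h‖) *
          (μ.real (Metric.ball (0 : E) 1) * (1 - (1 - ε) ^ d)) := by fun_prop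
    have := (hc.tendsto 0).mono_left (nhdsWithin_le_nhds (s := Ioi (0 : ℝ)))
    simpa using this
  refine le_of_tendsto_of_tendsto hl hr ?_
  filter_upwards [Ioo_mem_nhdsGT (zero_lt_one' ℝ)] with ε hε
  refine le_trans (le_of_eq ?_) (integral_sphere_mul_inner_le_aux μ hF h hconv hε.1 hε.2)
  have hg := mul_neg_geom_sum (1 - ε) d
  rw [← hg, ← hd]
  have := hε.1.ne'
  field_simp
  ring

end smoothing
end DistBandit

namespace DistBandit
open Set Filter Topology

/-! ### Euclidean projection. -/

section metricProj
variable {d : ℕ} {K : Set (Euc d)}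

theorem metricProj_mem (hne : K.Nonempty) (hcl : IsClosed K) (hcv : Convex ℝ K) (x : Euc d) :
    metricProj K x ∈ K := (metricProj_spec hne hcl hcv x).1

theorem metricProj_inner_le (hne : K.Nonempty) (hcl : IsClosed K) (hcv : Convex ℝ K) (x : Euc d)
    {y : Euc d} (hy : y ∈ K) : inner ℝ (x - metricProj K x) (y - metricProj K x) ≤ 0 := by
  obtain ⟨hm, hmin⟩ := metricProj_spec hne hcl hcv x
  refine (norm_eq_iInf_iff_real_inner_le_zero hcv hm).1 ?_ y hy
  have : Nonempty K := hne.to_subtype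
  refine le_antisymm (le_ciInf fun z => hmin z z.2) ?_
  exact ciInf_le ⟨0, by rintro _ ⟨w, rfl⟩; exact norm_nonneg _⟩ (⟨_, hm⟩ : K)

theorem metricProj_of_mem (hcl : IsClosed K) (hcv : Convex ℝ K) {x : Euc d} (hx : x ∈ K) :
    metricProj K x = x := by
  have := (metricProj_spec ⟨x, hx⟩ hcl hcv x).2 x hx
  rw [sub_self, norm_zero] at this
  exact (sub_eq_zero.1 (norm_le_zero_iff.1 this)).symm

theorem norm_metricProj_sub_le (hne : K.Nonempty) (hcl : IsClosed K) (hcv : Convex ℝ K)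
    (x y : Euc d) : ‖metricProj K x - metricProj K y‖ ≤ ‖x - y‖ := by
  have h1 := metricProj_inner_le hne hcl hcv x (metricProj_mem hne hcl hcv y)
  have h2 := metricProj_inner_le hne hcl hcv y (metricProj_mem hne hcl hcv x)
  set a := metricProj K x
  set b := metricProj K y
  have h3 : ‖a - b‖ ^ 2 ≤ inner ℝ (x - y) (a - b) := by
    have e1 : inner ℝ (x - a) (b - a) + inner ℝ (y - b) (a - b) =
        ‖a - b‖ ^ 2 - inner ℝ (x - y) (a - b) := by
      rw [← neg_sub a b, inner_neg_right, ← real_inner_self_eq_norm_sq]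
      simp only [inner_sub_left]
      ring
    linarith
  have h4 := real_inner_le_norm (x - y) (a - b)
  by_contra hlt
  push Not at hlt
  nlinarith [norm_nonneg (x - y)]

theorem lipschitzWith_metricProj (hne : K.Nonempty) (hcl : IsClosed K) (hcv : Convex ℝ K) :
    LipschitzWith 1 (metricProj K) :=
  LipschitzWith.of_dist_le_mul fun x y => by
    simpa [dist_eq_norm] using norm_metricProj_sub_le hne hcl hcv x y

end metricProj

/-! ### The mean of the two-point estimator. -/

theorem isProbabilityMeasure_uniformSphere {p : ℕ} (hp : 0 < p) :
    IsProbabilityMeasure (uniformSphere p) := by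
  have : Nonempty (Fin p) := ⟨⟨0, hp⟩⟩
  constructor
  rw [uniformSphere, Measure.smul_apply, smul_eq_mul]
  exact ENNReal.inv_mul_cancel
    (by simp [hp.ne', (Metric.measure_ball_pos (volume : Measure (Euc p)) 0 one_pos).ne'])
    (measure_ne_top _ _)

/-- Rescaling the exploration ball to the unit ball sends `y` to `e = δ⁻¹ • (y - x)`, and the
integrand becomes `-p F(u) ⟨u, e⟩`; the divergence inequality applies, and `p` cancels since the
sphere has area `p` times the ball volume. Precomposition with the projection makes `F` Lipschitz
everywhere. It may destroy convexity off `X`, but only segments from the ball to `e` matter, and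
these come from `X`. -/
theorem gradEst_lower_bound {p : ℕ} (hp : 0 < p) {X : Set (Euc p)} (hcl : IsClosed X)
    (hcv : Convex ℝ X) {h : Euc p → ℝ} (hconv : ConvexOn ℝ X h) {Λ : ℝ} (hΛ0 : 0 ≤ Λ)
    (hΛ : ∀ x ∈ X, ∀ y ∈ X, |h x - h y| ≤ Λ * ‖x - y‖) {x : Euc p} {δ : ℝ} (hδ : 0 < δ)
    (hball : ∀ v : Euc p, ‖v‖ ≤ 1 → x + δ • v ∈ X) {y : Euc p} (hy : y ∈ X) :
    h x - h y - 2 * (Λ * δ) ≤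
      ∫ u : UnitSphere p, inner ℝ (gradEst h δ x u) (x - y) ∂uniformSphere p := by
  have : Nonempty (Fin p) := ⟨⟨0, hp⟩⟩
  have hne : X.Nonempty := ⟨y, hy⟩
  have hx : x ∈ X := by simpa using hball 0 (by simp)
  set F : Euc p → ℝ := fun z => h (metricProj X (x + δ • z)) - h x with hF
  have hF1 : ∀ z, x + δ • z ∈ X → F z = h (x + δ • z) - h x := fun z hz => by
    rw [hF]; simp only; rw [metricProj_of_mem hcl hcv hz]
  have hFL : LipschitzWith (Real.toNNReal (Λ * δ)) F := by
    refine LipschitzWith.of_dist_le_mul fun a b => ?_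
    rw [Real.dist_eq, Real.coe_toNNReal _ (by positivity), hF, dist_eq_norm]
    simp only [sub_sub_sub_cancel_right]
    refine (hΛ _ (metricProj_mem hne hcl hcv _) _ (metricProj_mem hne hcl hcv _)).trans ?_
    rw [mul_assoc]
    gcongr
    refine (norm_metricProj_sub_le hne hcl hcv _ _).trans_eq ?_
    rw [add_sub_add_left_eq_sub, ← smul_sub, norm_smul, Real.norm_of_nonneg hδ.le]
  set e : Euc p := δ⁻¹ • (y - x) with he
  have hxe : x + δ • e = y := by rw [he, smul_inv_smul₀ hδ.ne']; abel
  have hFe : F e = h y - h x := by rw [hF1 e (by rwa [hxe]), hxe]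
  have hF0 : F 0 = 0 := by rw [hF1 0 (by simpa)]; simp
  have key := integral_sphere_mul_inner_le (volume : Measure (Euc p)) hFL e (by
    intro z hz s hs
    have hz' := hball z hz
    have e1 : x + δ • (z + s • (e - z)) = (1 - s) • (x + δ • z) + s • y := by
      rw [← hxe]; module
    have hm : (1 - s) • (x + δ • z) + s • y ∈ X :=
      hcv hz' hy (by linarith [hs.2]) hs.1.le (by ring)
    have hc := hconv.2 hz' hy (by linarith [hs.2] : 0 ≤ 1 - s) hs.1.le (by ring)
    rw [hF1 _ (by rwa [e1]), e1, hF1 _ hz', hFe]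
    simp only [smul_eq_mul] at hc
    linarith)
  rw [hFe, hF0, Real.coe_toNNReal _ (by positivity)] at key
  have hpt : ∀ u : UnitSphere p, inner ℝ (gradEst h δ x u) (x - y) =
      -(p : ℝ) * (F u * inner ℝ (u : Euc p) e) := by
    intro u
    rw [hF1 _ (hball u (by simp)), gradEst, he, inner_smul_left, inner_smul_right,
      ← neg_sub y x, inner_neg_right]
    simp only [conj_trivial]
    field_simp
  simp_rw [hpt]
  rw [uniformSphere, integral_smul_measure, integral_const_mul, ENNReal.toReal_inv,
    ← Measure.real, Measure.toSphere_real_apply_univ, finrank_euclideanSpace_fin, smul_eq_mul]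
  have hV : 0 < (volume : Measure (Euc p)).real (Metric.ball 0 1) :=
    ENNReal.toReal_pos (Metric.isOpen_ball.measure_ne_zero _ (by simp)) measure_ball_lt_top.ne
  set V := (volume : Measure (Euc p)).real (Metric.ball 0 1)
  set I := ∫ u : UnitSphere p, F u * inner ℝ (u : Euc p) e ∂(volume : Measure (Euc p)).toSphere
  have hp' : (0 : ℝ) < p := by exact_mod_cast hp
  rw [show ((p : ℝ) * V)⁻¹ * (-(p : ℝ) * I) = -(I / V) by field_simp]
  have : I / V ≤ h y - h x - 0 + 2 * (Λ * δ) := by rwa [div_le_iff₀' hV]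
  linarith

namespace Problem
variable {n p : ℕ} (M : Problem n p)

/-- The local Lagrangian `f_{i,t} + ⟨q, g_{i,t}⟩`. -/
noncomputable def lagr (i : Fin n) (t : ℕ) (q : Euc (M.m i)) (z : Euc p) : ℝ :=
  M.f i t z + inner ℝ q (M.g i t z)

/-- Both estimators use the same `u` and are linear in the function, so estimating scalar functions
is enough. -/
theorem direction_eq (a : Params) (t : ℕ) (i : Fin n) (x u : Euc p) :
    M.direction a t i x u = gradEst (M.lagr i t (M.dual a t i x)) (a.δ t) x u := by
  ext k
  simp only [direction, gradEst, jacEst, lagr, PiLp.add_apply, PiLp.smul_apply, smul_eq_mul,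
    Matrix.smul_mulVec, Matrix.vecMulVec_mulVec, Pi.smul_apply, PiLp.sub_apply]
  rw [PiLp.inner_apply, PiLp.inner_apply]
  simp only [dotProduct, RCLike.inner_apply, conj_trivial, MulOpposite.smul_eq_mul_unop,
    MulOpposite.unop_op, sub_mul, Finset.sum_sub_distrib]
  ring

end Problem
end DistBandit

namespace DistBandit

/-! ### Consensus: contraction of the spread under mixing. -/

theorem sum_Icc_one_eq {β : Type*} [AddCommMonoid β] (f : ℕ → β) (T : ℕ) :
    ∑ t ∈ Finset.Icc 1 T, f t = ∑ t ∈ Finset.range T, f (t + 1) := by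
  induction T with
  | zero => simp
  | succ T ih => rw [Finset.sum_Icc_succ_top (by omega), ih, Finset.sum_range_succ]

/-- The first `H` terms are each at most the total error, by `hinit`. In the sum of the later terms
each error occurs in at most `H` windows. This gives `2H` times the total error plus `lam` times the
sum itself, which moves to the left. -/
theorem sum_le_of_delayed_contraction {d e : ℕ → ℝ} (hd : ∀ t, 0 ≤ d t) (he : ∀ t, 0 ≤ e t)
    {H : ℕ} {lam : ℝ} (h0 : 0 ≤ lam) (h1 : lam < 1)
    (hstep : ∀ t, d (t + H) ≤ lam * d t + ∑ k ∈ Finset.range H, e (t + k))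
    (hinit : ∀ t, d t ≤ ∑ s ∈ Finset.range t, e s) (T : ℕ) :
    ∑ t ∈ Finset.range T, d t ≤ 2 * H / (1 - lam) * ∑ t ∈ Finset.range T, e t := by
  set E := ∑ t ∈ Finset.range T, e t with hE
  have hE0 : 0 ≤ E := Finset.sum_nonneg fun t _ => he t
  have hS0 : 0 ≤ ∑ t ∈ Finset.range T, d t := Finset.sum_nonneg fun t _ => hd t
  have hdE : ∀ t ≤ T, d t ≤ E := fun t ht => (hinit t).trans
    (Finset.sum_le_sum_of_subset_of_nonneg (Finset.range_mono ht) fun s _ _ => he s)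
  have key : ∑ t ∈ Finset.range T, d t ≤ 2 * H * E + lam * ∑ t ∈ Finset.range T, d t := by
    rcases le_total T H with hT | hT
    · have h2 : ∑ t ∈ Finset.range T, d t ≤ T * E := by
        refine (Finset.sum_le_card_nsmul _ _ E fun t ht => hdE t ?_).trans_eq ?_
        · exact (Finset.mem_range.1 ht).le
        · simp
      have h3 : (T : ℝ) ≤ H := by exact_mod_cast hT
      have h4 : (T : ℝ) * E ≤ H * E := by gcongr
      have h5 : 0 ≤ H * E := by positivity
      have h6 : 0 ≤ lam * ∑ t ∈ Finset.range T, d t := by positivity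
      linarith
    · obtain ⟨m, rfl⟩ := Nat.exists_eq_add_of_le hT
      rw [Finset.sum_range_add]
      have h2 : ∑ t ∈ Finset.range H, d t ≤ H * E := by
        refine (Finset.sum_le_card_nsmul _ _ E fun t ht => hdE t ?_).trans_eq ?_
        · have := Finset.mem_range.1 ht; omega
        · simp
      have h3 : ∑ t ∈ Finset.range m, d (H + t) ≤ lam * ∑ t ∈ Finset.range m, d t + H * E := by
        calc ∑ t ∈ Finset.range m, d (H + t)
            ≤ ∑ t ∈ Finset.range m, (lam * d t + ∑ k ∈ Finset.range H, e (t + k)) :=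
              Finset.sum_le_sum fun t _ => by rw [add_comm]; exact hstep t
          _ = lam * ∑ t ∈ Finset.range m, d t +
                ∑ k ∈ Finset.range H, ∑ t ∈ Finset.range m, e (t + k) := by
              rw [Finset.sum_add_distrib, Finset.mul_sum, Finset.sum_comm]
          _ ≤ lam * ∑ t ∈ Finset.range m, d t + H * E := by
              gcongr
              refine (Finset.sum_le_card_nsmul _ _ E fun k hk => ?_).trans_eq (by simp)
              have hk' := Finset.mem_range.1 hk
              calc ∑ t ∈ Finset.range m, e (t + k)
                  ≤ ∑ t ∈ Finset.range (k + m), e t := by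
                    rw [Finset.sum_range_add]
                    simp_rw [add_comm k]
                    exact le_add_of_nonneg_left (Finset.sum_nonneg fun t _ => he t)
                _ ≤ E := Finset.sum_le_sum_of_subset_of_nonneg
                    (Finset.range_mono (by omega)) fun s _ _ => he s
      have h4 : ∑ t ∈ Finset.range m, d t ≤
          ∑ t ∈ Finset.range H, d t + ∑ t ∈ Finset.range m, d (H + t) := by
        rw [← Finset.sum_range_add]
        exact Finset.sum_le_sum_of_subset_of_nonneg (Finset.range_mono (by omega))
          fun s _ _ => hd s
      have h5 := mul_le_mul_of_nonneg_left h4 h0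
      linarith
  rw [div_mul_eq_mul_div, le_div_iff₀ (by linarith)]
  linarith

section consensus
variable {n : ℕ} {V : Type*} [NormedAddCommGroup V]

/-- The action of a real matrix on families of vectors. -/
def matAct [NormedSpace ℝ V] (A : Matrix (Fin n) (Fin n) ℝ) (x : Fin n → V) (i : Fin n) : V := ∑ j, A i j • x j

/-- The largest distance between two members of a family. -/
noncomputable def spread (x : Fin n → V) : ℝ := ⨆ ij : Fin n × Fin n, ‖x ij.1 - x ij.2‖


theorem norm_sub_le_spread (x : Fin n → V) (i j : Fin n) : ‖x i - x j‖ ≤ spread x :=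
  le_ciSup (f := fun ij : Fin n × Fin n => ‖x ij.1 - x ij.2‖) (Set.finite_range _).bddAbove (i, j)

theorem spread_nonneg (x : Fin n → V) : 0 ≤ spread x := Real.iSup_nonneg fun _ => norm_nonneg _

theorem spread_le {x : Fin n → V} {d : ℝ} (hd : 0 ≤ d) (h : ∀ i j, ‖x i - x j‖ ≤ d) :
    spread x ≤ d := Real.iSup_le (fun ij => h ij.1 ij.2) hd

theorem spread_add_le (x y : Fin n → V) : spread (x + y) ≤ spread x + spread y := by
  refine spread_le (add_nonneg (spread_nonneg x) (spread_nonneg y)) fun i j => ?_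
  rw [Pi.add_apply, Pi.add_apply, add_sub_add_comm]
  exact (norm_add_le _ _).trans (add_le_add (norm_sub_le_spread x i j) (norm_sub_le_spread y i j))

theorem spread_le_sum_norm (x : Fin n → V) : spread x ≤ 2 * ∑ i, ‖x i‖ := by
  have h : ∀ i, ‖x i‖ ≤ ∑ i, ‖x i‖ := fun i =>
    Finset.single_le_sum (fun i _ => norm_nonneg (x i)) (Finset.mem_univ i)
  refine spread_le (by positivity) fun i j => ?_
  linarith [norm_sub_le (x i) (x j), h i, h j]

variable [NormedSpace ℝ V]

theorem matAct_one (x : Fin n → V) : matAct 1 x = x := by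
  funext i
  simp [matAct, Matrix.one_apply]

theorem matAct_mul (A C : Matrix (Fin n) (Fin n) ℝ) (x : Fin n → V) :
    matAct (A * C) x = matAct A (matAct C x) := by
  funext i
  simp only [matAct, Matrix.mul_apply, Finset.sum_smul, Finset.smul_sum, mul_smul]
  rw [Finset.sum_comm]

theorem matAct_add (A : Matrix (Fin n) (Fin n) ℝ) (x y : Fin n → V) :
    matAct A (x + y) = matAct A x + matAct A y := by
  funext i
  simp [matAct, smul_add, Finset.sum_add_distrib]

/-- Product coupling: the difference of outputs `i` and `j` averages `x k - x l` with weights `A i k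
* A j l`. Diagonal pairs contribute nothing, and one of them already has weight at least `η ^ 2`.
The case `η = 0` gives nonexpansiveness. -/
theorem spread_matAct_le {A : Matrix (Fin n) (Fin n) ℝ} {η : ℝ} (hη : 0 ≤ η)
    (hA : ∀ i j, η ≤ A i j) (hsum : ∀ i, ∑ j, A i j = 1) (x : Fin n → V) :
    spread (matAct A x) ≤ (1 - η ^ 2) * spread x := by
  rcases isEmpty_or_nonempty (Fin n) with hn | ⟨⟨k₀⟩⟩
  · simp [spread, Real.iSup_of_isEmpty]
  have hA0 : ∀ i j, 0 ≤ A i j := fun i j => hη.trans (hA i j)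
  have hη1 : η ≤ 1 := by
    refine (hA k₀ k₀).trans ?_
    rw [← hsum k₀]
    exact Finset.single_le_sum (fun j _ => hA0 k₀ j) (Finset.mem_univ k₀)
  have hs := spread_nonneg x
  refine spread_le (mul_nonneg (by nlinarith) hs) fun i j => ?_
  have e1 : matAct A x i = ∑ k, ∑ l, (A i k * A j l) • x k := by
    simp only [matAct]
    refine Finset.sum_congr rfl fun k _ => ?_
    rw [← Finset.sum_smul, ← Finset.mul_sum, hsum, mul_one]
  have e2 : matAct A x j = ∑ k, ∑ l, (A i k * A j l) • x l := by
    simp only [matAct]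
    rw [Finset.sum_comm]
    refine Finset.sum_congr rfl fun k _ => ?_
    rw [← Finset.sum_smul, ← Finset.sum_mul, hsum, one_mul]
  have e3 : ∑ k, ∑ l, A i k * A j l = 1 := by
    simp_rw [← Finset.mul_sum, hsum, mul_one, hsum]
  rw [e1, e2]
  simp_rw [← Finset.sum_sub_distrib, ← smul_sub]
  calc ‖∑ k, ∑ l, (A i k * A j l) • (x k - x l)‖
      ≤ ∑ k, ∑ l, (A i k * A j l) * (if k = l then 0 else spread x) := by
        refine (norm_sum_le _ _).trans (Finset.sum_le_sum fun k _ => ?_)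
        refine (norm_sum_le _ _).trans (Finset.sum_le_sum fun l _ => ?_)
        rw [norm_smul, Real.norm_of_nonneg (mul_nonneg (hA0 _ _) (hA0 _ _))]
        refine mul_le_mul_of_nonneg_left ?_ (mul_nonneg (hA0 _ _) (hA0 _ _))
        split_ifs with h
        · simp [h]
        · exact norm_sub_le_spread x k l
    _ = (1 - ∑ k, A i k * A j k) * spread x := by
        rw [sub_mul, ← e3, Finset.sum_mul, Finset.sum_mul, ← Finset.sum_sub_distrib]
        refine Finset.sum_congr rfl fun k _ => ?_
        rw [Finset.sum_mul, eq_sub_iff_add_eq]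
        have hk : A i k * A j k * spread x =
            ∑ l, if k = l then A i k * A j l * spread x else 0 := by simp
        rw [hk, ← Finset.sum_add_distrib]
        refine Finset.sum_congr rfl fun l _ => ?_
        split_ifs <;> simp
    _ ≤ (1 - η ^ 2) * spread x := by
        refine mul_le_mul_of_nonneg_right ?_ hs
        have : A i k₀ * A j k₀ ≤ ∑ k, A i k * A j k :=
          Finset.single_le_sum (fun k _ => mul_nonneg (hA0 i k) (hA0 j k)) (Finset.mem_univ k₀)
        nlinarith [hA i k₀, hA j k₀]

/-- The product `W_{t+m-1} ⋯ W_t` of `m` mixing matrices. -/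
noncomputable def transition (W : ℕ → Matrix (Fin n) (Fin n) ℝ) (t : ℕ) :
    ℕ → Matrix (Fin n) (Fin n) ℝ
  | 0 => 1
  | m + 1 => W (t + m) * transition W t m

theorem transition_mem {W : ℕ → Matrix (Fin n) (Fin n) ℝ}
    (hW : ∀ t, 1 ≤ t → W t ∈ doublyStochastic ℝ (Fin n)) {t : ℕ} (ht : 1 ≤ t) (m : ℕ) :
    transition W t m ∈ doublyStochastic ℝ (Fin n) := by
  induction m with
  | zero => exact one_mem _
  | succ m ih => exact mul_mem (hW _ (by omega)) ih

/-- Disturbances pass through nonexpansive matrices, so their spreads merely add up. The product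
starts at `t + 1` because `W (t + 1)` produces `x (t + 1)`. -/
theorem exists_disturbed_expansion {W : ℕ → Matrix (Fin n) (Fin n) ℝ}
    (hW : ∀ t, 1 ≤ t → W t ∈ doublyStochastic ℝ (Fin n)) {x ε : ℕ → Fin n → V}
    (hx : ∀ t, 1 ≤ t → x (t + 1) = matAct (W (t + 1)) (x t + ε t)) {t : ℕ} (ht : 1 ≤ t) (m : ℕ) :
    ∃ ρ : Fin n → V, x (t + m) = matAct (transition W (t + 1) m) (x t) + ρ ∧
      spread ρ ≤ ∑ k ∈ Finset.range m, spread (ε (t + k)) := by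
  induction m with
  | zero =>
    refine ⟨0, by simp [transition, matAct_one], ?_⟩
    exact spread_le (by simp) (by simp)
  | succ m ih =>
    obtain ⟨ρ, h1, h2⟩ := ih
    refine ⟨matAct (W (t + 1 + m)) (ρ + ε (t + m)), ?_, ?_⟩
    · rw [← add_assoc t m 1, hx (t + m) (by omega), h1, transition, matAct_mul, ← matAct_add,
        add_assoc (matAct _ _), add_right_comm t m 1]
    · rw [Finset.sum_range_succ]
      have h3 := hW (t + 1 + m) (by omega)
      have h4 := spread_matAct_le (V := V) le_rfl (fun i j => nonneg_of_mem_doublyStochastic h3)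
        (sum_row_of_mem_doublyStochastic h3) (ρ + ε (t + m))
      have h5 := spread_add_le ρ (ε (t + m))
      linarith

end consensus

namespace Problem
variable {n p : ℕ} {M : Problem n p} {w : ℝ} {B : ℕ}

/-- Lengthening a path from `j` by one edge or self-loop costs a factor `w`. -/
theorem NetworkAssumption.transition_step (hN : M.NetworkAssumption w B) (hw : 0 < w) {t : ℕ}
    (ht : 1 ≤ t) {m : ℕ} {i j b : Fin n} (hi : w ^ m ≤ transition M.W t m i j)
    (hb : (i, b) ∈ M.edges (t + m) ∨ b = i) : w ^ (m + 1) ≤ transition M.W t (m + 1) b j := by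
  have h1 := hN.weight_ge (t + m) (by omega) b i hb
  have h2 := hN.doubly_stochastic (t + m) (by omega)
  have h3 := transition_mem hN.doubly_stochastic ht m
  rw [transition, Matrix.mul_apply, pow_succ']
  refine (mul_le_mul h1 hi (by positivity) (hw.le.trans h1)).trans ?_
  exact Finset.single_le_sum (f := fun a => M.W (t + m) b a * transition M.W t m a j)
    (fun a _ => mul_nonneg (nonneg_of_mem_doublyStochastic h2) (nonneg_of_mem_doublyStochastic h3))
    (Finset.mem_univ i)

-- Let `S m` be the agents that `j` reaches in `m` steps with weight at least `w ^ m`. Self-loops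
-- make it increasing. If it stayed constant over a window of length `B`, it would be closed under
-- all edges of that window and, by strong connectivity, contain every agent. So each window adds an
-- agent until all are reached, and `n` windows suffice.
open Classical in
theorem NetworkAssumption.transition_ge (hN : M.NetworkAssumption w B) (hw : 0 < w) {t : ℕ}
    (ht : 1 ≤ t) (i j : Fin n) : w ^ (n * B) ≤ transition M.W t (n * B) i j := by
  set S : ℕ → Finset (Fin n) := fun m => {i | w ^ m ≤ transition M.W t m i j} with hS
  have hmem : ∀ m i, i ∈ S m ↔ w ^ m ≤ transition M.W t m i j := fun m i => by simp [hS]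
  have hmono : Monotone S := monotone_nat_of_le_succ fun m i hi =>
    (hmem _ _).2 (hN.transition_step hw ht ((hmem _ _).1 hi) (Or.inr rfl))
  have hj : ∀ m, j ∈ S m := fun m => hmono (Nat.zero_le m) ((hmem _ _).2 (by simp [transition]))
  have hgrow : ∀ m, S m ≠ Finset.univ → (S m).card + 1 ≤ (S (m + B)).card := by
    intro m hm
    refine Finset.card_lt_card ((hmono (Nat.le_add_right m B)).lt_of_ne fun heq => hm ?_)
    have hSl : ∀ l ≤ B, S (m + l) = S m := fun l hl => by
      refine le_antisymm ?_ (hmono (by omega))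
      exact (hmono (by omega : m + l ≤ m + B)).trans heq.ge
    refine Finset.eq_univ_iff_forall.2 fun b => ?_
    have hc := hN.connected (t + m) (by omega) j b
    induction hc with
    | refl => exact hj m
    | @tail a b _ hab ih =>
      simp only [Set.mem_iUnion, Finset.mem_range] at hab
      obtain ⟨l, hl, he⟩ := hab
      rw [← hSl (l + 1) hl, ← add_assoc]
      refine (hmem _ _).2 (hN.transition_step hw ht (i := a) ((hmem _ _).1 ?_) (Or.inl ?_))
      · rw [hSl l hl.le]; exact ih
      · rw [← add_assoc]; exact he
  have hcard : ∀ k ≤ n, k ≤ (S (k * B)).card := by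
    intro k
    induction k with
    | zero => simp
    | succ k ih =>
      intro hk
      rw [Nat.succ_mul]
      by_cases hu : S (k * B) = Finset.univ
      · have : S (k * B + B) = Finset.univ :=
          Finset.univ_subset_iff.1 (hu ▸ hmono (Nat.le_add_right (k * B) B))
        rw [this]; simpa using hk
      · have h1 := hgrow _ hu
        have h2 := ih (by omega)
        omega
  have huniv : S (n * B) = Finset.univ := by
    rw [← Finset.card_eq_iff_eq_univ]
    exact le_antisymm (Finset.card_le_univ _) (by simpa using hcard n le_rfl)
  exact (hmem _ _).1 (huniv ▸ Finset.mem_univ i)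

/-- The constant in the consensus error bound. -/
noncomputable def consensusConst (n : ℕ) (w : ℝ) (B : ℕ) : ℝ :=
  4 * (n * B : ℕ) / (w ^ (n * B)) ^ 2

theorem consensusConst_nonneg (n : ℕ) (w : ℝ) (B : ℕ) : 0 ≤ consensusConst n w B := by
  unfold consensusConst; positivity

/-- Delayed contraction with delay `n * B` and factor `1 - η ^ 2`; the zero start supplies the
initial bound. The constant is `2nB / η ^ 2` times the factor 2 of `spread_le_sum_norm`. -/
theorem NetworkAssumption.sum_spread_le (hN : M.NetworkAssumption w B) (hn : 0 < n)
    (hw : w ∈ Set.Ioo (0 : ℝ) 1) (hB : 0 < B) {V : Type*} [NormedAddCommGroup V]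
    [NormedSpace ℝ V] {x ε : ℕ → Fin n → V} (hx1 : x 1 = 0)
    (hx : ∀ t, 1 ≤ t → x (t + 1) = matAct (M.W (t + 1)) (x t + ε t)) (T : ℕ) :
    ∑ t ∈ Finset.Icc 1 T, spread (x t) ≤
      consensusConst n w B * ∑ t ∈ Finset.Icc 1 T, ∑ i, ‖ε t i‖ := by
  set η := w ^ (n * B) with hη
  have hη0 : 0 < η := pow_pos hw.1 _
  have hη1 : η < 1 := pow_lt_one₀ hw.1.le hw.2 (by positivity)
  have hs0 : spread (0 : Fin n → V) = 0 :=
    le_antisymm (spread_le le_rfl (by simp)) (spread_nonneg _)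
  rw [sum_Icc_one_eq, sum_Icc_one_eq]
  have key := sum_le_of_delayed_contraction (d := fun t => spread (x (t + 1)))
    (e := fun t => spread (ε (t + 1))) (fun t => spread_nonneg _) (fun t => spread_nonneg _)
    (H := n * B) (lam := 1 - η ^ 2) (by nlinarith) (by nlinarith) (fun t => by
      obtain ⟨ρ, h1, h2⟩ := exists_disturbed_expansion hN.doubly_stochastic hx
        (Nat.le_add_left 1 t) (n * B)
      have h3 := transition_mem hN.doubly_stochastic (by omega : 1 ≤ t + 1 + 1) (n * B)
      have h4 := spread_matAct_le hη0.le
        (fun i j => hN.transition_ge hw.1 (by omega : 1 ≤ t + 1 + 1) i j)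
        (sum_row_of_mem_doublyStochastic h3) (x (t + 1))
      have h5 := spread_add_le (matAct (transition M.W (t + 1 + 1) (n * B)) (x (t + 1))) ρ
      rw [← h1] at h5
      simp only [add_right_comm t _ 1]
      linarith) (fun t => by
      obtain ⟨ρ, h1, h2⟩ := exists_disturbed_expansion hN.doubly_stochastic hx le_rfl t
      have h3 : matAct (transition M.W (1 + 1) t) (0 : Fin n → V) = 0 := by
        funext i; simp [matAct]
      rw [hx1, h3, zero_add] at h1
      rw [add_comm t 1, h1]
      simpa only [add_comm 1] using h2) T
  refine key.trans ?_
  rw [show consensusConst n w B = 2 * ((n * B : ℕ) : ℝ) / (1 - (1 - η ^ 2)) * 2 by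
    rw [consensusConst, sub_sub_cancel, ← hη]; ring, mul_assoc]
  refine mul_le_mul_of_nonneg_left ?_ ?_
  · rw [Finset.mul_sum]
    exact Finset.sum_le_sum fun t _ => spread_le_sum_norm _
  · rw [sub_sub_cancel]; positivity

end Problem
end DistBandit

namespace DistBandit

/-! ### Positive parts, projected steps and regularity of the local functions. -/

section clip
variable {ι : Type} [Fintype ι]

theorem norm_clip_le_add (a b : EuclideanSpace ℝ ι) : ‖clip a‖ ≤ ‖clip b‖ + ‖a - b‖ := by
  have h1 : ‖clip a - clip b‖ ≤ ‖a - b‖ := by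
    rw [EuclideanSpace.norm_eq, EuclideanSpace.norm_eq]
    refine Real.sqrt_le_sqrt (Finset.sum_le_sum fun k _ => ?_)
    have := abs_max_sub_max_le_abs (a k) (b k) 0
    simp only [clip, PiLp.sub_apply, Real.norm_eq_abs]
    gcongr
  have h2 := norm_add_le (clip b) (clip a - clip b)
  rw [add_sub_cancel] at h2
  linarith

theorem inner_clip_self (a : EuclideanSpace ℝ ι) : inner ℝ (clip a) a = ‖clip a‖ ^ 2 := by
  rw [EuclideanSpace.norm_sq_eq, PiLp.inner_apply]
  refine Finset.sum_congr rfl fun k _ => ?_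
  simp only [clip, RCLike.inner_apply, conj_trivial, Real.norm_eq_abs, sq_abs]
  rcases le_total (a k) 0 with h | h
  · simp [h]
  · simp [h, sq]

/-- The sum of the entries of a nonnegative vector dominates its Euclidean norm. The case `ς = 0`
serves feasible comparators, the case `ς > 0` the Slater point. -/
theorem inner_clip_le {ς : ℝ} (hς : 0 ≤ ς) (a b : EuclideanSpace ℝ ι) (hb : ∀ k, b k ≤ -ς) :
    inner ℝ (clip a) b ≤ -ς * ‖clip a‖ := by
  have h0 : ∀ k, 0 ≤ clip a k := fun k => le_max_right _ _
  have h1 : ‖clip a‖ ≤ ∑ k, clip a k := by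
    calc ‖clip a‖ ≤ ∑ k, ‖clip a k‖ := by
          rw [EuclideanSpace.norm_eq]
          refine Real.sqrt_le_iff.2 ⟨Finset.sum_nonneg fun k _ => norm_nonneg _, ?_⟩
          exact Finset.sum_sq_le_sq_sum_of_nonneg fun k _ => norm_nonneg _
      _ = ∑ k, clip a k := Finset.sum_congr rfl fun k _ => Real.norm_of_nonneg (h0 k)
  rw [PiLp.inner_apply]
  calc ∑ k, inner ℝ (clip a k) (b k) ≤ ∑ k, -ς * clip a k := by
        refine Finset.sum_le_sum fun k _ => ?_
        simp only [RCLike.inner_apply, conj_trivial]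
        exact mul_le_mul_of_nonneg_right (hb k) (h0 k)
    _ = -ς * ∑ k, clip a k := by rw [Finset.mul_sum]
    _ ≤ -ς * ‖clip a‖ := by nlinarith

end clip

theorem smul_set_mono {d : ℕ} {X : Set (Euc d)} (hcv : Convex ℝ X) (h0 : (0 : Euc d) ∈ X)
    {s s' : ℝ} (hs : 0 ≤ s) (hss : s ≤ s') : s • X ⊆ s' • X := by
  rintro _ ⟨y, hy, rfl⟩
  rcases hs.eq_or_lt with rfl | hs
  · exact ⟨0, h0, by simp⟩
  · have hs' : 0 < s' := hs.trans_le hss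
    refine ⟨(s / s') • y, ?_, ?_⟩
    · have := hcv h0 hy (sub_nonneg.2 ((div_le_one hs').2 hss)) (by positivity : 0 ≤ s / s')
        (by ring)
      simpa using this
    · simp only [smul_smul]
      rw [mul_div_cancel₀ _ hs'.ne']

/-- One projected step from `x ∈ K` in direction `-b`, compared with a point `y` at distance at
most `ρ` from `K`. -/
theorem projected_step {d : ℕ} {K : Set (Euc d)} (hcl : IsClosed K) (hcv : Convex ℝ K)
    {x y y' b : Euc d} {α ρ : ℝ} (hα : 0 < α) (hx : x ∈ K) (hy' : y' ∈ K) (hρ : ‖y - y'‖ ≤ ρ) :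
    inner ℝ b (x - y) ≤ (‖x - y‖ ^ 2 - ‖metricProj K (x - α • b) - y‖ ^ 2) / (2 * α) +
        α * ‖b‖ ^ 2 / 2 + ρ * ‖b‖ ∧
      ‖metricProj K (x - α • b) - x‖ ≤ α * ‖b‖ := by
  have hne : K.Nonempty := ⟨x, hx⟩
  have h1 : ‖metricProj K (x - α • b) - x‖ ≤ α * ‖b‖ := by
    have := norm_metricProj_sub_le hne hcl hcv (x - α • b) x
    rwa [metricProj_of_mem hcl hcv hx, sub_sub_cancel_left, norm_neg, norm_smul,
      Real.norm_of_nonneg hα.le] at this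
  refine ⟨?_, h1⟩
  have h2 := (metricProj_spec hne hcl hcv (x - α • b)).2 x hx
  have h3 := metricProj_inner_le hne hcl hcv (x - α • b) hy'
  set z := metricProj K (x - α • b)
  rw [sub_sub_cancel_left, norm_neg, norm_smul, Real.norm_of_nonneg hα.le] at h2
  -- The variational inequality holds at `y' ∈ K`; passing to `y` costs `ρ` times the projection
  -- distance, which is at most `α‖b‖` because `x ∈ K`.
  have h4 : inner ℝ (x - α • b - z) (y - z) ≤ α * ‖b‖ * ρ := by
    have e : y - z = (y' - z) + (y - y') := by abel
    rw [e, inner_add_right]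
    have h5 := real_inner_le_norm (x - α • b - z) (y - y')
    have h6 : ‖x - α • b - z‖ * ‖y - y'‖ ≤ α * ‖b‖ * ρ :=
      mul_le_mul h2 hρ (norm_nonneg _) (by positivity)
    linarith
  have h7 : ‖x - α • b - y‖ ^ 2 = ‖x - α • b - z‖ ^ 2 -
      2 * inner ℝ (x - α • b - z) (y - z) + ‖z - y‖ ^ 2 := by
    rw [← norm_neg (z - y), neg_sub, ← norm_sub_sq_real, sub_sub_sub_cancel_right]
  have h8 : ‖x - α • b - y‖ ^ 2 =
      ‖x - y‖ ^ 2 - 2 * (α * inner ℝ b (x - y)) + α ^ 2 * ‖b‖ ^ 2 := by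
    rw [sub_right_comm, norm_sub_sq_real, inner_smul_right, norm_smul, mul_pow,
      Real.norm_of_nonneg hα.le, real_inner_comm]
  have h9 : 2 * (α * inner ℝ b (x - y)) ≤
      ‖x - y‖ ^ 2 - ‖z - y‖ ^ 2 + α ^ 2 * ‖b‖ ^ 2 + 2 * (α * ‖b‖ * ρ) := by
    nlinarith [sq_nonneg ‖x - α • b - z‖]
  have h10 : inner ℝ b (x - y) ≤
      (‖x - y‖ ^ 2 - ‖z - y‖ ^ 2 + α ^ 2 * ‖b‖ ^ 2 + 2 * (α * ‖b‖ * ρ)) / (2 * α) := by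
    rw [le_div_iff₀ (by positivity)]; linarith
  refine h10.trans_eq ?_
  field_simp

namespace Problem
variable {n p : ℕ} {M : Problem n p} {r R G₁ G₂ : ℝ}

section regularity

theorem SetAssumption.zero_mem (hS : M.SetAssumption r R) (hr : 0 < r) : (0 : Euc p) ∈ M.X :=
  hS.inner (by simp [hr.le])

theorem SetAssumption.norm_le (hS : M.SetAssumption r R) {x : Euc p} (hx : x ∈ M.X) :
    ‖x‖ ≤ R := by simpa using hS.outer hx

theorem SetAssumption.R_nonneg (hS : M.SetAssumption r R) (hr : 0 < r) : 0 ≤ R := by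
  simpa using hS.norm_le (hS.zero_mem hr)

theorem SetAssumption.isCompact (hS : M.SetAssumption r R) : IsCompact M.X :=
  (isCompact_closedBall 0 R).of_isClosed_subset hS.closed hS.outer

theorem ConvexAssumption.G₁_nonneg (hC : M.ConvexAssumption G₁ G₂) (hn : 0 < n)
    (hne : M.X.Nonempty) : 0 ≤ G₁ := by
  obtain ⟨x, hx⟩ := hne
  obtain ⟨v, hv, -⟩ := hC.subgrad_f ⟨0, hn⟩ 1 le_rfl x hx
  exact (norm_nonneg v).trans hv

theorem ConvexAssumption.G₂_nonneg (hC : M.ConvexAssumption G₁ G₂) (hn : 0 < n)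
    (hne : M.X.Nonempty) : 0 ≤ G₂ := by
  obtain ⟨x, hx⟩ := hne
  obtain ⟨v, hv, -⟩ := hC.subgrad_g ⟨0, hn⟩ 1 le_rfl x hx
  exact (norm_nonneg v).trans hv

theorem ConvexAssumption.f_sub_le (hC : M.ConvexAssumption G₁ G₂) {i : Fin n} {t : ℕ}
    (ht : 1 ≤ t) {x y : Euc p} (hx : x ∈ M.X) (hy : y ∈ M.X) :
    M.f i t x - M.f i t y ≤ G₁ * ‖x - y‖ := by
  obtain ⟨v, hv, h⟩ := hC.subgrad_f i t ht x hx
  have h1 := h y hy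
  rw [← neg_sub x y, inner_neg_right] at h1
  have h2 := real_inner_le_norm v (x - y)
  have h3 : ‖v‖ * ‖x - y‖ ≤ G₁ * ‖x - y‖ := by gcongr
  linarith

theorem ConvexAssumption.abs_f_sub_le (hC : M.ConvexAssumption G₁ G₂) {i : Fin n} {t : ℕ}
    (ht : 1 ≤ t) {x y : Euc p} (hx : x ∈ M.X) (hy : y ∈ M.X) :
    |M.f i t x - M.f i t y| ≤ G₁ * ‖x - y‖ := by
  refine abs_le.2 ⟨?_, hC.f_sub_le ht hx hy⟩
  have := hC.f_sub_le (i := i) ht hy hx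
  rw [norm_sub_rev] at this
  linarith

/-- Subgradients at `y` and at `x` bound each component from below and above. Its sign decides which
bound controls its square, so both linear images enter; this is the source of the factor 2. -/
theorem ConvexAssumption.norm_g_sub_le (hC : M.ConvexAssumption G₁ G₂) {i : Fin n} {t : ℕ}
    (ht : 1 ≤ t) {x y : Euc p} (hx : x ∈ M.X) (hy : y ∈ M.X) :
    ‖M.g i t x - M.g i t y‖ ≤ 2 * G₂ * ‖x - y‖ := by
  obtain ⟨D, hD, h⟩ := hC.subgrad_g i t ht x hx
  obtain ⟨D', hD', h'⟩ := hC.subgrad_g i t ht y hy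
  set a := D (x - y)
  set b := D' (x - y)
  have hk : ∀ k, b k ≤ (M.g i t x - M.g i t y) k ∧ (M.g i t x - M.g i t y) k ≤ a k := by
    intro k
    have h1 := h y hy k
    rw [← neg_sub x y, map_neg, PiLp.neg_apply] at h1
    have h2 := h' x hx k
    rw [PiLp.sub_apply]
    exact ⟨by linarith, by linarith⟩
  have h3 : ‖M.g i t x - M.g i t y‖ ^ 2 ≤ ‖a‖ ^ 2 + ‖b‖ ^ 2 := by
    simp only [EuclideanSpace.norm_sq_eq, Real.norm_eq_abs, sq_abs]
    rw [← Finset.sum_add_distrib]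
    refine Finset.sum_le_sum fun k _ => ?_
    obtain ⟨h1, h2⟩ := hk k
    rcases le_total 0 ((M.g i t x - M.g i t y) k) with h0 | h0 <;> nlinarith
  have h5 : ‖a‖ ≤ G₂ * ‖x - y‖ := D.le_of_opNorm_le hD _
  have h6 : ‖b‖ ≤ G₂ * ‖x - y‖ := D'.le_of_opNorm_le hD' _
  have h7 : ‖M.g i t x - M.g i t y‖ ^ 2 ≤ (‖a‖ + ‖b‖) ^ 2 := by
    nlinarith [norm_nonneg a, norm_nonneg b]
  have h8 := abs_le_of_sq_le_sq h7 (by positivity)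
  linarith [(le_abs_self _).trans h8]

/-- The positive part of the local constraint violation. -/
noncomputable def viol (M : Problem n p) (t : ℕ) (i : Fin n) (x : Euc p) : ℝ := ‖clip (M.g i t x)‖

theorem norm_dual {a : Params} {t : ℕ} (ha : 0 ≤ a.γ t) (i : Fin n) (x : Euc p) :
    ‖M.dual a t i x‖ = a.γ t * M.viol t i x := by
  rw [dual, norm_smul, Real.norm_of_nonneg ha, viol]

theorem ConvexAssumption.abs_lagr_sub_le (hC : M.ConvexAssumption G₁ G₂) {i : Fin n} {t : ℕ}
    (ht : 1 ≤ t) (q : Euc (M.m i)) {x y : Euc p} (hx : x ∈ M.X) (hy : y ∈ M.X) :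
    |M.lagr i t q x - M.lagr i t q y| ≤ (G₁ + 2 * G₂ * ‖q‖) * ‖x - y‖ := by
  have h1 := hC.abs_f_sub_le (i := i) ht hx hy
  have h2 : |inner ℝ q (M.g i t x - M.g i t y)| ≤ ‖q‖ * (2 * G₂ * ‖x - y‖) :=
    (abs_real_inner_le_norm _ _).trans (by gcongr; exact hC.norm_g_sub_le ht hx hy)
  have h3 := abs_add_le (M.f i t x - M.f i t y) (inner ℝ q (M.g i t x - M.g i t y))
  rw [lagr, lagr, show M.f i t x + inner ℝ q (M.g i t x) - (M.f i t y + inner ℝ q (M.g i t y)) =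
    M.f i t x - M.f i t y + inner ℝ q (M.g i t x - M.g i t y) by rw [inner_sub_right]; ring]
  linarith

theorem ConvexAssumption.convexOn_lagr (hC : M.ConvexAssumption G₁ G₂) {i : Fin n} {t : ℕ}
    (ht : 1 ≤ t) {q : Euc (M.m i)} (hq : ∀ k, 0 ≤ q k) : ConvexOn ℝ M.X (M.lagr i t q) := by
  refine (hC.convex_f i t ht).add ⟨(hC.convex_f i t ht).1, fun x hx y hy a b ha hb hab => ?_⟩
  simp only [PiLp.inner_apply, RCLike.inner_apply, conj_trivial, smul_eq_mul, Finset.mul_sum]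
  rw [← Finset.sum_add_distrib]
  refine Finset.sum_le_sum fun k _ => ?_
  have := mul_le_mul_of_nonneg_right ((hC.convex_g i t ht k).2 hx hy ha hb hab) (hq k)
  simp only [smul_eq_mul] at this
  linarith

theorem dual_nonneg {a : Params} {t : ℕ} (ha : 0 ≤ a.γ t) (i : Fin n) (x : Euc p)
    (k : Fin (M.m i)) : 0 ≤ M.dual a t i x k := mul_nonneg ha (le_max_right _ _)

/-- The increment over distance `δ` is at most `δ` times the Lipschitz constant of the Lagrangian,
which cancels the `1/δ` of the estimator. -/
theorem ConvexAssumption.norm_direction_le (hC : M.ConvexAssumption G₁ G₂) {a : Params} {i : Fin n}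
    {t : ℕ} (ht : 1 ≤ t) (hγ : 0 ≤ a.γ t) (hδ : 0 < a.δ t) {x : Euc p}
    (hball : ∀ v : Euc p, ‖v‖ ≤ 1 → x + a.δ t • v ∈ M.X) (u : UnitSphere p) :
    ‖M.direction a t i x u‖ ≤ p * (G₁ + 2 * G₂ * (a.γ t * M.viol t i x)) := by
  have hx : x ∈ M.X := by simpa using hball 0 (by simp)
  have hu : ‖(u : Euc p)‖ = 1 := by simp
  have h1 := hC.abs_lagr_sub_le ht (M.dual a t i x) (hball u hu.le) hx
  rw [add_sub_cancel_left, norm_smul, Real.norm_of_nonneg hδ.le, hu, mul_one, norm_dual hγ] at h1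
  rw [direction_eq, gradEst, norm_smul, hu, mul_one, norm_mul, norm_div, Real.norm_natCast,
    Real.norm_of_nonneg hδ.le, Real.norm_eq_abs, div_mul_eq_mul_div, div_le_iff₀ hδ, mul_assoc]
  gcongr

/-- The defect in the subgradient inequality of the two-point estimator; its mean over the
exploration direction is nonpositive. -/
noncomputable def noise (M : Problem n p) (a : Params) (G₁ G₂ : ℝ) (t : ℕ) (i : Fin n)
    (y x u : Euc p) : ℝ :=
  M.lagr i t (M.dual a t i x) x - M.lagr i t (M.dual a t i x) y -
    2 * ((G₁ + 2 * G₂ * ‖M.dual a t i x‖) * a.δ t) - inner ℝ (M.direction a t i x u) (x - y)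

theorem lagr_dual_sub {a : Params} (t : ℕ) (i : Fin n) (x y : Euc p) :
    M.lagr i t (M.dual a t i x) x - M.lagr i t (M.dual a t i x) y =
      M.f i t x - M.f i t y + a.γ t * M.viol t i x ^ 2 -
        a.γ t * inner ℝ (clip (M.g i t x)) (M.g i t y) := by
  rw [lagr, lagr, dual, inner_smul_left, inner_smul_left, inner_clip_self, viol]
  simp only [conj_trivial]
  ring

end regularity
end Problem
end DistBandit

namespace DistBandit

/-! ### Step-size sums and scalar estimates. -/

section scalar

/-- The step size `t^{-c}`. -/
noncomputable def rate (c : ℝ) (t : ℕ) : ℝ := 1 / (t : ℝ) ^ c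

variable {c : ℝ}

theorem rate_pos {t : ℕ} (ht : 1 ≤ t) : 0 < rate c t := by
  have : (0 : ℝ) < t := by exact_mod_cast ht
  unfold rate; positivity

theorem rate_one : rate c 1 = 1 := by simp [rate]

theorem rate_antitone (hc : 0 ≤ c) {s t : ℕ} (hs : 1 ≤ s) (hst : s ≤ t) :
    rate c t ≤ rate c s := by
  have h1 : (0 : ℝ) < s := by exact_mod_cast hs
  have h2 : (s : ℝ) ≤ t := by exact_mod_cast hst
  unfold rate
  exact one_div_le_one_div_of_le (by positivity) (Real.rpow_le_rpow h1.le h2 hc)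

theorem rate_le_one (hc : 0 ≤ c) {t : ℕ} (ht : 1 ≤ t) : rate c t ≤ 1 := by
  simpa [rate_one] using rate_antitone hc le_rfl ht

theorem sum_rate_le (hc : c ∈ Set.Ioo (0 : ℝ) 1) (T : ℕ) :
    ∑ t ∈ Finset.Icc 1 T, rate c t ≤ (T : ℝ) ^ (1 - c) / (1 - c) := by
  have hc1 : 0 < 1 - c := by linarith [hc.2]
  induction T with
  | zero => simp [Real.zero_rpow hc1.ne']
  | succ T ih =>
    rw [Finset.sum_Icc_succ_top (by omega)]
    have hT : (0 : ℝ) < (T : ℝ) + 1 := by positivity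
    have hT0 : (0 : ℝ) ≤ T := by positivity
    -- Bernoulli's inequality for the concave power `1 - c`, applied to `T / (T + 1)`, replaces
    -- comparison with an integral.
    have hb := rpow_one_add_le_one_add_mul_self (s := -1 / ((T : ℝ) + 1)) (p := 1 - c)
      (by rw [le_div_iff₀ hT]; linarith) hc1.le (by linarith [hc.1])
    have e1 : 1 + -1 / ((T : ℝ) + 1) = T / (T + 1) := by field_simp; ring
    rw [e1, Real.div_rpow hT0 hT.le] at hb
    have hpos : 0 < ((T : ℝ) + 1) ^ (1 - c) := Real.rpow_pos_of_pos hT _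
    rw [div_le_iff₀ hpos] at hb
    have e2 : rate c (T + 1) = ((T : ℝ) + 1) ^ (1 - c) / (T + 1) := by
      rw [rate, Real.rpow_sub hT, Real.rpow_one]
      push_cast
      field_simp
    rw [e2]
    have e3 : (T : ℝ) ^ (1 - c) / (1 - c) + ((T : ℝ) + 1) ^ (1 - c) / (T + 1) ≤
        ((T : ℝ) + 1) ^ (1 - c) / (1 - c) := by
      rw [← sub_nonneg]
      have : ((T : ℝ) + 1) ^ (1 - c) / (1 - c) -
          ((T : ℝ) ^ (1 - c) / (1 - c) + ((T : ℝ) + 1) ^ (1 - c) / (T + 1)) =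
          ((1 + (1 - c) * (-1 / ((T : ℝ) + 1))) * ((T : ℝ) + 1) ^ (1 - c) - (T : ℝ) ^ (1 - c)) /
            (1 - c) := by
        field_simp
        ring
      rw [this]
      exact div_nonneg (by linarith) hc1.le
    push_cast
    linarith

/-- Summation by parts against the increasing weights `1 / α_t`. -/
theorem sum_sub_div_rate_le (hc : 0 ≤ c) {Z : ℕ → ℝ} {D : ℝ} (hZ0 : ∀ t, 1 ≤ t → 0 ≤ Z t)
    (hZ : ∀ t, 1 ≤ t → Z t ≤ D) {T : ℕ} (hT : 1 ≤ T) :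
    ∑ t ∈ Finset.Icc 1 T, (Z t - Z (t + 1)) / (2 * rate c t) ≤ D / 2 * (T : ℝ) ^ c := by
  have key : ∀ T : ℕ, 1 ≤ T → ∑ t ∈ Finset.Icc 1 T, (Z t - Z (t + 1)) / (2 * rate c t) ≤
      (D - Z (T + 1)) / (2 * rate c T) := by
    intro T hT
    induction T, hT using Nat.le_induction with
    | base =>
      have := hZ 1 le_rfl
      simp only [Finset.Icc_self, Finset.sum_singleton, rate_one]
      linarith
    | succ T hT ih =>
      rw [Finset.sum_Icc_succ_top (by omega)]
      have h1 := rate_antitone hc hT (Nat.le_succ T)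
      have h2 := rate_pos (c := c) (Nat.le_add_left 1 T)
      have h3 : (D - Z (T + 1)) / (2 * rate c T) ≤ (D - Z (T + 1)) / (2 * rate c (T + 1)) := by
        have := hZ (T + 1) (by omega)
        exact div_le_div_of_nonneg_left (by linarith) (by positivity) (by simpa using h1)
      have h4 : (D - Z (T + 1)) / (2 * rate c (T + 1)) +
          (Z (T + 1) - Z (T + 1 + 1)) / (2 * rate c (T + 1)) =
          (D - Z (T + 1 + 1)) / (2 * rate c (T + 1)) := by rw [← add_div]; ring
      linarith
  refine (key T hT).trans ?_
  have h1 : (0 : ℝ) < (T : ℝ) ^ c := Real.rpow_pos_of_pos (by exact_mod_cast hT) _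
  have h2 := hZ0 (T + 1) (by omega)
  rw [rate]
  rw [show (D - Z (T + 1)) / (2 * (1 / (T : ℝ) ^ c)) = (D - Z (T + 1)) / 2 * (T : ℝ) ^ c by
    field_simp]
  gcongr
  linarith

/-- Completing the square: a penalty of weight `1/α` absorbs any linear violation term at a cost
proportional to `α`. -/
theorem linear_le_quadratic {β k α e : ℝ} (hk : 0 < k) (hα : 0 < α) :
    β * e ≤ k / α * e ^ 2 + α * (β ^ 2 / (4 * k)) := by
  have h : 0 ≤ k / α * (e - α * β / (2 * k)) ^ 2 := by positivity
  have e1 : k / α * (e - α * β / (2 * k)) ^ 2 = k / α * e ^ 2 + α * (β ^ 2 / (4 * k)) - β * e := by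
    field_simp
    ring
  linarith

/-- The scalar estimate behind the one-step inequality: the estimator norm is at most
`b = p (G₁ + 2 G₂ (γ₀/α) e)`. -/
theorem one_step_scalar {P G₁ G₂ γ₀ α α' R r e b : ℝ} (hP : 0 ≤ P) (hG₁ : 0 ≤ G₁) (hG₂ : 0 ≤ G₂)
    (hγ₀ : 0 < γ₀) (hγ : 4 * (P ^ 2 + 1) * G₂ ^ 2 * γ₀ ≤ 1) (hα : 0 < α)
    (hα' : α' ≤ α) (hR : 0 ≤ R) (he : 0 ≤ e) (hb0 : 0 ≤ b)
    (hb : b ≤ P * (G₁ + 2 * G₂ * (γ₀ / α * e))) :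
    α * b ^ 2 / 2 + α' * R * b + 2 * ((G₁ + 2 * G₂ * (γ₀ / α * e)) * (r * α)) ≤
      (1 - 1 / (P ^ 2 + 1)) * (γ₀ / α * e ^ 2) +
        α * (P ^ 2 * G₁ ^ 2 + R * P * G₁ + 2 * r * G₁) + 2 * G₂ * γ₀ * (R * P + 2 * r) * e := by
  have h1 : α' * R * b ≤ α * R * (P * (G₁ + 2 * G₂ * (γ₀ / α * e))) := by gcongr
  have h2 : b ^ 2 ≤ 2 * (P ^ 2 * (G₁ ^ 2 + (2 * G₂ * (γ₀ / α * e)) ^ 2)) := by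
    calc b ^ 2 ≤ (P * (G₁ + 2 * G₂ * (γ₀ / α * e))) ^ 2 := by gcongr
      _ = P ^ 2 * (G₁ + 2 * G₂ * (γ₀ / α * e)) ^ 2 := by ring
      _ ≤ P ^ 2 * (2 * (G₁ ^ 2 + (2 * G₂ * (γ₀ / α * e)) ^ 2)) := by
        gcongr; exact add_sq_le
      _ = _ := by ring
  have h3 : α * b ^ 2 / 2 ≤ α * (P ^ 2 * (G₁ ^ 2 + (2 * G₂ * (γ₀ / α * e)) ^ 2)) := by
    have := mul_le_mul_of_nonneg_left h2 hα.le
    linarith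
  have h4 : α * (P ^ 2 * (G₁ ^ 2 + (2 * G₂ * (γ₀ / α * e)) ^ 2)) =
      α * (P ^ 2 * G₁ ^ 2) + 4 * P ^ 2 * G₂ ^ 2 * γ₀ * (γ₀ / α * e ^ 2) := by
    field_simp
    ring
  -- The smallness of `γ₀` is used here: the quadratic part of the squared estimator norm leaves the
  -- fraction `1 / (P ^ 2 + 1)` of the penalty.
  have h5 : 4 * P ^ 2 * G₂ ^ 2 * γ₀ ≤ 1 - 1 / (P ^ 2 + 1) := by
    rw [show (1 : ℝ) - 1 / (P ^ 2 + 1) = P ^ 2 / (P ^ 2 + 1) by field_simp; ring,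
      le_div_iff₀ (by positivity)]
    nlinarith [sq_nonneg P]
  have h6 : 4 * P ^ 2 * G₂ ^ 2 * γ₀ * (γ₀ / α * e ^ 2) ≤
      (1 - 1 / (P ^ 2 + 1)) * (γ₀ / α * e ^ 2) := by gcongr
  have h7 : α * R * (P * (G₁ + 2 * G₂ * (γ₀ / α * e))) +
      2 * ((G₁ + 2 * G₂ * (γ₀ / α * e)) * (r * α)) =
      α * (R * P * G₁ + 2 * r * G₁) + 2 * G₂ * γ₀ * (R * P + 2 * r) * e := by
    field_simp
  linarith

end scalar

/-- Unit row sums give Jensen's inequality for the square; unit column sums collapse the double sum.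
-/
theorem sum_norm_matAct_sub_sq_le {n : ℕ} {V : Type*} [NormedAddCommGroup V] [NormedSpace ℝ V]
    {A : Matrix (Fin n) (Fin n) ℝ} (hA : A ∈ doublyStochastic ℝ (Fin n)) (z : Fin n → V) (y : V) :
    ∑ i, ‖matAct A z i - y‖ ^ 2 ≤ ∑ j, ‖z j - y‖ ^ 2 := by
  have h0 : ∀ i j, 0 ≤ A i j := fun i j => nonneg_of_mem_doublyStochastic hA
  have h1 : ∀ i, ‖matAct A z i - y‖ ^ 2 ≤ ∑ j, A i j * ‖z j - y‖ ^ 2 := by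
    intro i
    have e1 : matAct A z i - y = ∑ j, A i j • (z j - y) := by
      simp only [smul_sub, Finset.sum_sub_distrib, ← Finset.sum_smul,
        sum_row_of_mem_doublyStochastic hA i, one_smul, matAct]
    have e2 : ‖matAct A z i - y‖ ≤ ∑ j, A i j * ‖z j - y‖ := by
      rw [e1]
      refine (norm_sum_le _ _).trans_eq (Finset.sum_congr rfl fun j _ => ?_)
      rw [norm_smul, Real.norm_of_nonneg (h0 i j)]
    calc ‖matAct A z i - y‖ ^ 2 ≤ (∑ j, A i j * ‖z j - y‖) ^ 2 := by gcongr
      _ ≤ ∑ j, A i j * ‖z j - y‖ ^ 2 := by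
        have := (convexOn_pow (𝕜 := ℝ) 2).map_sum_le (t := Finset.univ) (w := fun j => A i j)
          (p := fun j => ‖z j - y‖) (fun j _ => h0 i j)
          (sum_row_of_mem_doublyStochastic hA i) (fun j _ => norm_nonneg (z j - y))
        simpa only [smul_eq_mul] using this
  calc ∑ i, ‖matAct A z i - y‖ ^ 2 ≤ ∑ i, ∑ j, A i j * ‖z j - y‖ ^ 2 :=
        Finset.sum_le_sum fun i _ => h1 i
    _ = ∑ j, ‖z j - y‖ ^ 2 := by
        rw [Finset.sum_comm]
        refine Finset.sum_congr rfl fun j _ => ?_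
        rw [← Finset.sum_mul, sum_col_of_mem_doublyStochastic hA j, one_mul]

/-! ### Shrunken decision sets and invariance of the iterates. -/

namespace Problem
variable {n p : ℕ} {M : Problem n p} {r R G₁ G₂ w c γ₀ : ℝ} {B : ℕ}

/-- The shrunken decision set `(1 - ξ_t) X`. -/
def shrunk (M : Problem n p) (c : ℝ) (t : ℕ) : Set (Euc p) := (1 - rate c t) • M.X

theorem isClosed_shrunk {t : ℕ} (hS : M.SetAssumption r R) : IsClosed (M.shrunk c t) := (hS.isCompact.smul _).isClosed

theorem convex_shrunk {t : ℕ} (hS : M.SetAssumption r R) : Convex ℝ (M.shrunk c t) := hS.convex.smul _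

theorem zero_mem_shrunk {t : ℕ} (hS : M.SetAssumption r R) (hr : 0 < r) :
    (0 : Euc p) ∈ M.shrunk c t := ⟨0, hS.zero_mem hr, by simp⟩

theorem shrunk_subset {t : ℕ} (hS : M.SetAssumption r R) (hr : 0 < r) (hc : 0 ≤ c)
    (ht : 1 ≤ t) :
    M.shrunk c t ⊆ M.X := by
  have := smul_set_mono hS.convex (hS.zero_mem hr) (sub_nonneg.2 (rate_le_one hc ht))
    (sub_le_self 1 (rate_pos (c := c) ht).le)
  rwa [one_smul] at this

theorem shrunk_succ {t : ℕ} (hS : M.SetAssumption r R) (hr : 0 < r) (hc : 0 ≤ c)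
    (ht : 1 ≤ t) :
    M.shrunk c t ⊆ M.shrunk c (t + 1) :=
  smul_set_mono hS.convex (hS.zero_mem hr) (sub_nonneg.2 (rate_le_one hc ht))
    (sub_le_sub_left (rate_antitone hc ht (Nat.le_succ t)) 1)

/-- The point is a convex combination of a point of `X` and `r • v`, with weights `1 - α_t` and
`α_t`. This is what the choices `ξ_t = α_t` and `δ_t = r α_t` are for. -/
theorem add_mem_of_mem_shrunk {t : ℕ} (hS : M.SetAssumption r R) (hr : 0 < r) (hc : 0 ≤ c)
    (ht : 1 ≤ t) {x v : Euc p} (hx : x ∈ M.shrunk c t) (hv : ‖v‖ ≤ 1) :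
    x + (r * rate c t) • v ∈ M.X := by
  obtain ⟨x', hx', rfl⟩ := hx
  have h1 : r • v ∈ M.X := hS.inner (by
    rw [mem_closedBall_zero_iff, norm_smul, Real.norm_of_nonneg hr.le]
    nlinarith)
  have := hS.convex hx' h1 (sub_nonneg.2 (rate_le_one hc ht)) (rate_pos (c := c) ht).le (by ring)
  rwa [smul_smul, mul_comm] at this

theorem zIter_succ (a : Params) (z₁ : Fin n → Euc p) (u : ℕ → Fin n → UnitSphere p) {t : ℕ}
    (ht : 1 ≤ t) : M.zIter a z₁ u (t + 1) = M.step a t (u t) (M.zIter a z₁ u t) := by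
  obtain ⟨s, rfl⟩ := Nat.exists_eq_add_of_le' ht
  rfl

theorem mix_eq (t : ℕ) (z : Fin n → Euc p) : M.mix t z = matAct (M.W t) z := rfl

theorem mix_mem {t : ℕ} (hW : M.W t ∈ doublyStochastic ℝ (Fin n)) {K : Set (Euc p)}
    (hK : Convex ℝ K) {z : Fin n → Euc p} (hz : ∀ i, z i ∈ K) (i : Fin n) : M.mix t z i ∈ K :=
  hK.sum_mem (fun _ _ => nonneg_of_mem_doublyStochastic hW)
    (sum_row_of_mem_doublyStochastic hW i) fun j _ => hz j

variable {z₁ : Fin n → Euc p} {u : ℕ → Fin n → UnitSphere p}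

theorem zIter_mem (hS : M.SetAssumption r R) (hr : 0 < r)
    (hz₁ : ∀ i, z₁ i ∈ M.shrunk c 1) {t : ℕ} (ht : 1 ≤ t) (i : Fin n) :
    M.zIter (powerParams c γ₀ r) z₁ u t i ∈ M.shrunk c t := by
  rcases ht.eq_or_lt with rfl | h
  · exact hz₁ i
  · obtain ⟨s, rfl⟩ := Nat.exists_eq_add_of_le' h
    exact metricProj_mem ⟨0, zero_mem_shrunk hS hr⟩ (isClosed_shrunk hS)
      (convex_shrunk hS) _

theorem xIter_mem (hS : M.SetAssumption r R) (hr : 0 < r)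
    (hN : M.NetworkAssumption w B)
    (hz₁ : ∀ i, z₁ i ∈ M.shrunk c 1) {t : ℕ} (ht : 1 ≤ t) (i : Fin n) :
    M.xIter (powerParams c γ₀ r) z₁ u t i ∈ M.shrunk c t :=
  mix_mem (hN.doubly_stochastic t ht) (convex_shrunk hS) (zIter_mem hS hr hz₁ ht) i

end Problem
end DistBandit

/-! ### The one-step inequality and the cumulative consensus error. -/

namespace DistBandit
namespace Problem
variable {n p : ℕ}

/-- The assumptions on the problem and the parameters that both bounds rely on. -/
structure Standing (M : Problem n p) (r R G₁ G₂ w : ℝ) (B : ℕ) (c γ₀ : ℝ) : Prop where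
  set : M.SetAssumption r R
  cvx : M.ConvexAssumption G₁ G₂
  net : M.NetworkAssumption w B
  n_pos : 0 < n
  p_pos : 0 < p
  r_pos : 0 < r
  w_mem : w ∈ Set.Ioo (0 : ℝ) 1
  B_pos : 0 < B
  c_mem : c ∈ Set.Ioo (0 : ℝ) 1
  γ_pos : 0 < γ₀
  γ_le : 4 * ((p : ℝ) ^ 2 + 1) * G₂ ^ 2 * γ₀ ≤ 1

/-- The coefficient of `α_t` in the one-step inequality. -/
noncomputable def constA (p : ℕ) (r R G₁ : ℝ) : ℝ :=
  (p : ℝ) ^ 2 * G₁ ^ 2 + R * p * G₁ + 2 * r * G₁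

/-- The coefficient of the local violation in the one-step inequality. -/
noncomputable def constV (p : ℕ) (r R G₂ γ₀ : ℝ) : ℝ := 2 * G₂ * γ₀ * (R * p + 2 * r)

variable {M : Problem n p} {r R G₁ G₂ w c γ₀ : ℝ} {B : ℕ}

namespace Standing
variable (H : M.Standing r R G₁ G₂ w B c γ₀)
include H

theorem G₁_nonneg : 0 ≤ G₁ := H.cvx.G₁_nonneg H.n_pos ⟨0, H.set.zero_mem H.r_pos⟩

theorem G₂_nonneg : 0 ≤ G₂ := H.cvx.G₂_nonneg H.n_pos ⟨0, H.set.zero_mem H.r_pos⟩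

theorem R_nonneg : 0 ≤ R := H.set.R_nonneg H.r_pos

/-- The projected step is compared with `y` through `(1 - ξ_{t+1}) • y`, at distance at most
`ξ_{t+1} R`. The inner product with `g(y)` is kept so that `y` can be either the offline optimum or
the Slater point. The second estimate bounds the disturbance in the consensus recursion. -/
theorem one_step {t : ℕ} (ht : 1 ≤ t) (i : Fin n) {x y : Euc p} (hx : x ∈ M.shrunk c t)
    (hy : y ∈ M.X) (u : UnitSphere p) :
    M.f i t x - M.f i t y - γ₀ / rate c t * inner ℝ (clip (M.g i t x)) (M.g i t y) +
        1 / ((p : ℝ) ^ 2 + 1) * (γ₀ / rate c t * M.viol t i x ^ 2) ≤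
      M.noise (powerParams c γ₀ r) G₁ G₂ t i y x u +
        (‖x - y‖ ^ 2 - ‖metricProj (M.shrunk c (t + 1))
          (x - rate c t • M.direction (powerParams c γ₀ r) t i x u) - y‖ ^ 2) / (2 * rate c t) +
        rate c t * constA p r R G₁ + constV p r R G₂ γ₀ * M.viol t i x ∧
    ‖metricProj (M.shrunk c (t + 1))
        (x - rate c t • M.direction (powerParams c γ₀ r) t i x u) - x‖ ≤
      p * G₁ * rate c t + 2 * p * G₂ * γ₀ * M.viol t i x := by
  have hα := rate_pos (c := c) ht
  have hc := H.c_mem.1.le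
  set α := rate c t with hαdef
  set a := powerParams c γ₀ r with ha
  have haγ : a.γ t = γ₀ / α := rfl
  have haδ : a.δ t = r * α := rfl
  have hγ0 : 0 ≤ a.γ t := div_nonneg H.γ_pos.le hα.le
  have hδ0 : 0 < a.δ t := mul_pos H.r_pos hα
  set b := M.direction a t i x u with hb
  set e := M.viol t i x with he
  have he0 : 0 ≤ e := norm_nonneg _
  have hbn : ‖b‖ ≤ p * (G₁ + 2 * G₂ * (γ₀ / α * e)) :=
    H.cvx.norm_direction_le ht hγ0 hδ0
      (fun v hv => add_mem_of_mem_shrunk H.set H.r_pos hc ht hx hv) u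
  have hy' : (1 - rate c (t + 1)) • y ∈ M.shrunk c (t + 1) := ⟨y, hy, rfl⟩
  have hdist : ‖y - (1 - rate c (t + 1)) • y‖ ≤ rate c (t + 1) * R := by
    have h1 := rate_pos (c := c) (Nat.le_add_left 1 t)
    rw [sub_smul, one_smul, sub_sub_cancel, norm_smul, Real.norm_of_nonneg h1.le]
    have := H.set.norm_le hy
    gcongr
  obtain ⟨h1, h2⟩ := projected_step (b := b) (isClosed_shrunk H.set) (convex_shrunk H.set) hα
    (shrunk_succ H.set H.r_pos hc ht hx) hy' hdist
  have h3 := one_step_scalar (r := r) (α' := rate c (t + 1)) (Nat.cast_nonneg p) H.G₁_nonneg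
    H.G₂_nonneg H.γ_pos H.γ_le hα (rate_antitone hc ht (Nat.le_succ t)) H.R_nonneg he0
    (norm_nonneg b) hbn
  have hnoise : M.noise a G₁ G₂ t i y x u = M.f i t x - M.f i t y + γ₀ / α * e ^ 2 -
      γ₀ / α * inner ℝ (clip (M.g i t x)) (M.g i t y) -
        2 * ((G₁ + 2 * G₂ * (γ₀ / α * e)) * (r * α)) - inner ℝ b (x - y) := by
    rw [noise, lagr_dual_sub, norm_dual hγ0, haγ, haδ]
  constructor
  · rw [hnoise, constA, constV]
    linarith
  · refine h2.trans ((mul_le_mul_of_nonneg_left hbn hα.le).trans_eq ?_)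
    field_simp

variable {z₁ : Fin n → Euc p} (hz₁ : ∀ i, z₁ i ∈ M.shrunk c 1) (u : ℕ → Fin n → UnitSphere p)
include hz₁

theorem xIter_mem_X {t : ℕ} (ht : 1 ≤ t) (i : Fin n) :
    M.xIter (powerParams c γ₀ r) z₁ u t i ∈ M.X :=
  shrunk_subset H.set H.r_pos H.c_mem.1.le ht (xIter_mem H.set H.r_pos H.net hz₁ ht i)

/-- The one-step inequality summed over the agents. -/
theorem sum_one_step {t : ℕ} (ht : 1 ≤ t) {y : Euc p} (hy : y ∈ M.X) :
    ∑ i, (M.f i t (M.xIter (powerParams c γ₀ r) z₁ u t i) - M.f i t y -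
        γ₀ / rate c t * inner ℝ (clip (M.g i t (M.xIter (powerParams c γ₀ r) z₁ u t i)))
          (M.g i t y) +
        1 / ((p : ℝ) ^ 2 + 1) *
          (γ₀ / rate c t * M.viol t i (M.xIter (powerParams c γ₀ r) z₁ u t i) ^ 2) -
        M.noise (powerParams c γ₀ r) G₁ G₂ t i y (M.xIter (powerParams c γ₀ r) z₁ u t i) (u t i) -
        rate c t * constA p r R G₁ -
        constV p r R G₂ γ₀ * M.viol t i (M.xIter (powerParams c γ₀ r) z₁ u t i)) ≤
      (∑ i, ‖M.zIter (powerParams c γ₀ r) z₁ u t i - y‖ ^ 2 -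
        ∑ i, ‖M.zIter (powerParams c γ₀ r) z₁ u (t + 1) i - y‖ ^ 2) / (2 * rate c t) := by
  set x := M.xIter (powerParams c γ₀ r) z₁ u t with hx
  have h1 : ∑ i, ‖x i - y‖ ^ 2 ≤ ∑ i, ‖M.zIter (powerParams c γ₀ r) z₁ u t i - y‖ ^ 2 :=
    sum_norm_matAct_sub_sq_le (H.net.doubly_stochastic t ht) _ y
  have h2 : (∑ i, ‖x i - y‖ ^ 2 -
      ∑ i, ‖M.zIter (powerParams c γ₀ r) z₁ u (t + 1) i - y‖ ^ 2) / (2 * rate c t) ≤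
      (∑ i, ‖M.zIter (powerParams c γ₀ r) z₁ u t i - y‖ ^ 2 -
        ∑ i, ‖M.zIter (powerParams c γ₀ r) z₁ u (t + 1) i - y‖ ^ 2) / (2 * rate c t) := by
    have := rate_pos (c := c) ht
    gcongr
  refine le_trans ?_ h2
  rw [← Finset.sum_sub_distrib, Finset.sum_div]
  refine Finset.sum_le_sum fun i _ => ?_
  have h3 := (H.one_step ht i (xIter_mem (γ₀ := γ₀) (u := u) H.set H.r_pos H.net hz₁ ht i) hy (u t i)).1
  rw [zIter_succ _ _ _ ht]
  change _ ≤ (‖x i - y‖ ^ 2 - ‖metricProj (M.shrunk c (t + 1))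
    (x i - rate c t • M.direction (powerParams c γ₀ r) t i (x i) (u t i)) - y‖ ^ 2) /
      (2 * rate c t)
  rw [← hx] at h3
  linarith

theorem sum_dist_mem {t : ℕ} (ht : 1 ≤ t) {y : Euc p} (hy : y ∈ M.X) :
    ∑ i, ‖M.zIter (powerParams c γ₀ r) z₁ u t i - y‖ ^ 2 ≤ n * (2 * R) ^ 2 := by
  have h : ∀ i ∈ Finset.univ, ‖M.zIter (powerParams c γ₀ r) z₁ u t i - y‖ ^ 2 ≤ (2 * R) ^ 2 := by
    intro i _
    have h1 := H.set.norm_le (shrunk_subset H.set H.r_pos H.c_mem.1.le ht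
      (zIter_mem (γ₀ := γ₀) (u := u) H.set H.r_pos hz₁ ht i))
    have h2 := H.set.norm_le hy
    have h3 := norm_sub_le (M.zIter (powerParams c γ₀ r) z₁ u t i) y
    gcongr
    linarith
  simpa using Finset.sum_le_card_nsmul _ _ _ h

/-- The cumulative consensus error. -/
theorem sum_spread_xIter_le (T : ℕ) :
    ∑ t ∈ Finset.Icc 1 T, spread (M.xIter (powerParams c γ₀ r) z₁ u t) ≤
      consensusConst n w B * ∑ t ∈ Finset.Icc 1 T, ∑ i, (p * G₁ * rate c t +
        2 * p * G₂ * γ₀ * M.viol t i (M.xIter (powerParams c γ₀ r) z₁ u t i)) := by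
  set z := M.zIter (powerParams c γ₀ r) z₁ u
  set x := M.xIter (powerParams c γ₀ r) z₁ u with hx
  -- Since `ξ_1 = 1`, the initial set is `{0}`, so consensus starts with zero spread.
  have hz1 : z 1 = 0 := by
    funext i
    obtain ⟨y, -, hy⟩ := zIter_mem (γ₀ := γ₀) (u := u) H.set H.r_pos hz₁ le_rfl i
    rw [rate_one] at hy
    simpa using hy.symm
  have key := H.net.sum_spread_le H.n_pos H.w_mem H.B_pos (x := x)
    (ε := fun t => z (t + 1) - x t) (by
      rw [hx, xIter, mix_eq]
      change matAct (M.W 1) (z 1) = 0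
      rw [hz1]
      funext i; simp [matAct]) (fun t _ => by rw [add_sub_cancel]; rfl) T
  refine key.trans (mul_le_mul_of_nonneg_left ?_ (consensusConst_nonneg _ _ _))
  refine Finset.sum_le_sum fun t ht => Finset.sum_le_sum fun i _ => ?_
  have ht1 := (Finset.mem_Icc.1 ht).1
  -- The displacement bound does not involve the comparator, so `0` serves.
  have h3 := (H.one_step ht1 i (xIter_mem (γ₀ := γ₀) (u := u) H.set H.r_pos H.net hz₁ ht1 i)
    (H.set.zero_mem H.r_pos) (u t i)).2
  change ‖M.zIter (powerParams c γ₀ r) z₁ u (t + 1) i - _‖ ≤ _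
  rw [zIter_succ _ _ _ ht1]
  exact h3

end Standing
end Problem
end DistBandit

/-! ### Pathwise bounds on regret and constraint violation. -/

namespace DistBandit
namespace Problem
variable {n p : ℕ}

/-- Regret evaluates the loss of agent `j` at the decision of agent `i`, whereas the algorithm
controls it at the decision of `j`; the exchange costs the spread. -/
theorem globalLoss_sub_le {M : Problem n p} {G₁ G₂ : ℝ} (hC : M.ConvexAssumption G₁ G₂)
    (hn : 0 < n) (hG : 0 ≤ G₁) {t : ℕ} (ht : 1 ≤ t) {x : Fin n → Euc p} (hx : ∀ i, x i ∈ M.X)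
    (y : Euc p) (i : Fin n) :
    M.globalLoss t (x i) - M.globalLoss t y ≤
      ∑ j, 1 / (n : ℝ) * (M.f j t (x j) - M.f j t y) + G₁ * spread x := by
  have hn' : (0 : ℝ) < n := by exact_mod_cast hn
  have h1 : ∀ j ∈ Finset.univ, M.f j t (x i) - M.f j t (x j) ≤ G₁ * spread x := fun j _ =>
    (hC.f_sub_le ht (hx i) (hx j)).trans (by gcongr; exact norm_sub_le_spread x i j)
  have h2 := Finset.sum_le_card_nsmul _ _ _ h1
  rw [Finset.card_univ, Fintype.card_fin, nsmul_eq_mul] at h2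
  have h3 : 1 / (n : ℝ) * ∑ j, (M.f j t (x i) - M.f j t (x j)) ≤ G₁ * spread x := by
    rw [one_div, inv_mul_le_iff₀ hn']; exact h2
  rw [← Finset.mul_sum, globalLoss, globalLoss]
  simp only [Finset.sum_sub_distrib, mul_sub] at h3 ⊢
  linarith

theorem norm_clip_globalConstraint_le {M : Problem n p} {G₁ G₂ : ℝ}
    (hC : M.ConvexAssumption G₁ G₂) (hG : 0 ≤ G₂) {t : ℕ} (ht : 1 ≤ t) {x : Fin n → Euc p}
    (hx : ∀ i, x i ∈ M.X) (i : Fin n) :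
    ‖clip (M.globalConstraint t (x i))‖ ≤
      ∑ j, M.viol t j (x j) + n * (2 * G₂ * spread x) := by
  have h1 : ‖clip (M.globalConstraint t (x i))‖ ≤ ∑ j, ‖clip (M.g j t (x i))‖ := by
    have e1 : ‖clip (M.globalConstraint t (x i))‖ ^ 2 = ∑ j, ‖clip (M.g j t (x i))‖ ^ 2 := by
      simp only [EuclideanSpace.norm_sq_eq]
      rw [Fintype.sum_sigma]
      rfl
    refine le_of_sq_le_sq ?_ (Finset.sum_nonneg fun j _ => norm_nonneg _)
    rw [e1]
    exact Finset.sum_sq_le_sq_sum_of_nonneg fun j _ => norm_nonneg _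
  have h2 : ∀ j, ‖clip (M.g j t (x i))‖ ≤ M.viol t j (x j) + 2 * G₂ * spread x := fun j =>
    (norm_clip_le_add _ (M.g j t (x j))).trans (by
      have := hC.norm_g_sub_le (i := j) ht (hx i) (hx j)
      have h4 : 2 * G₂ * ‖x i - x j‖ ≤ 2 * G₂ * spread x := by
        gcongr; exact norm_sub_le_spread x i j
      rw [viol]
      linarith)
  refine h1.trans ((Finset.sum_le_sum fun j _ => h2 j).trans_eq ?_)
  rw [Finset.sum_add_distrib]
  simp

/-- The coefficient of `α_t` in the regret bound. -/
noncomputable def regretRate (n p : ℕ) (r R G₁ G₂ w : ℝ) (B : ℕ) (γ₀ : ℝ) : ℝ :=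
  constA p r R G₁ / n + G₁ * (consensusConst n w B * (p * G₁)) +
    (constV p r R G₂ γ₀ / n + G₁ * (consensusConst n w B * (2 * p * G₂ * γ₀))) ^ 2 /
      (4 * (1 / ((p : ℝ) ^ 2 + 1) * γ₀ / n))

/-- The constant in the regret bound. -/
noncomputable def regretConst (n p : ℕ) (r R G₁ G₂ w : ℝ) (B : ℕ) (c γ₀ : ℝ) : ℝ :=
  (2 * R) ^ 2 / 2 + n * regretRate n p r R G₁ G₂ w B γ₀ / (1 - c)

/-- The coefficient of `α_t` in the bound on the cumulative local violation. -/
noncomputable def violRate (p : ℕ) (r R G₁ G₂ γ₀ F : ℝ) : ℝ :=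
  constA p r R G₁ + 2 * F + constV p r R G₂ γ₀ ^ 2 / (4 * (1 / ((p : ℝ) ^ 2 + 1) * γ₀))

/-- The factor between network violation and cumulative local violation. -/
noncomputable def violFactor (n p : ℕ) (G₂ w : ℝ) (B : ℕ) (γ₀ : ℝ) : ℝ :=
  1 + n * (2 * G₂ * (consensusConst n w B * (2 * p * G₂ * γ₀)))

/-- The constant in the bound on the cumulative constraint violation. -/
noncomputable def ccvConst (n p : ℕ) (r R G₁ G₂ w : ℝ) (B : ℕ) (c γ₀ F ς : ℝ) : ℝ :=
  violFactor n p G₂ w B γ₀ * (1 / (ς * γ₀)) *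
      (n * (2 * R) ^ 2 / 2 + n * violRate p r R G₁ G₂ γ₀ F / (1 - c)) +
    n * (2 * G₂ * (consensusConst n w B * (n * (p * G₁)))) / (1 - c)

variable {M : Problem n p} {r R G₁ G₂ w c γ₀ : ℝ} {B : ℕ}

theorem sum_const_mul_rate (q : ℝ) (T : ℕ) :
    ∑ t ∈ Finset.Icc 1 T, ∑ _i : Fin n, q * rate c t = n * q * ∑ t ∈ Finset.Icc 1 T, rate c t := by
  simp only [Finset.sum_const, Finset.card_univ, Fintype.card_fin, nsmul_eq_mul]
  rw [Finset.mul_sum]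
  exact Finset.sum_congr rfl fun t _ => by ring

namespace Standing

/-- Feasibility of `y` gives `-⟨[g(x)]₊, g(y)⟩` a favourable sign, so it is dropped. The telescope
has increasing weights `1/α_t` and costs `T^c`; the remaining errors are multiples of `α_t` and sum
to `T^(1-c)`. -/
theorem regret_path_le (H : M.Standing r R G₁ G₂ w B c γ₀) {z₁ : Fin n → Euc p}
    (hz₁ : ∀ i, z₁ i ∈ M.shrunk c 1) (u : ℕ → Fin n → UnitSphere p) {T : ℕ} (hT : 1 ≤ T)
    {y : Euc p} (hy : y ∈ M.feasibleSet T) :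
    1 / (n : ℝ) * ∑ i, (∑ t ∈ Finset.Icc 1 T,
        M.globalLoss t (M.xIter (powerParams c γ₀ r) z₁ u t i) -
          ∑ t ∈ Finset.Icc 1 T, M.globalLoss t y) ≤
      regretConst n p r R G₁ G₂ w B c γ₀ * (T : ℝ) ^ max c (1 - c) +
        ∑ t ∈ Finset.Icc 1 T, ∑ i, 1 / (n : ℝ) * M.noise (powerParams c γ₀ r) G₁ G₂ t i y
          (M.xIter (powerParams c γ₀ r) z₁ u t i) (u t i) := by
  have hn : (0 : ℝ) < n := by exact_mod_cast H.n_pos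
  have hT' : (1 : ℝ) ≤ T := by exact_mod_cast hT
  have hc1 : 0 < 1 - c := by linarith [H.c_mem.2]
  set x := M.xIter (powerParams c γ₀ r) z₁ u with hx
  set z := M.zIter (powerParams c γ₀ r) z₁ u with hz
  have hxX : ∀ t, 1 ≤ t → ∀ i, x t i ∈ M.X := fun t ht i => H.xIter_mem_X hz₁ u ht i
  set Z : ℕ → ℝ := fun t => ∑ i, ‖z t i - y‖ ^ 2 with hZ
  set κ : ℝ := 1 / ((p : ℝ) ^ 2 + 1) with hκ
  have hκ0 : 0 < κ := by positivity
  have hγ := H.γ_pos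
  set ν : ℕ → Fin n → ℝ := fun t i => M.noise (powerParams c γ₀ r) G₁ G₂ t i y (x t i) (u t i)
    with hν
  set CW := consensusConst n w B with hCW
  set A := constA p r R G₁
  set V := constV p r R G₂ γ₀
  -- decoupling
  have h1 : 1 / (n : ℝ) * ∑ i, (∑ t ∈ Finset.Icc 1 T, M.globalLoss t (x t i) -
      ∑ t ∈ Finset.Icc 1 T, M.globalLoss t y) ≤
      ∑ t ∈ Finset.Icc 1 T, (∑ j, 1 / (n : ℝ) * (M.f j t (x t j) - M.f j t y) +
        G₁ * spread (x t)) := by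
    rw [one_div, inv_mul_le_iff₀ hn]
    refine (Finset.sum_le_card_nsmul _ _ (∑ t ∈ Finset.Icc 1 T,
      (∑ j, 1 / (n : ℝ) * (M.f j t (x t j) - M.f j t y) + G₁ * spread (x t)))
        fun i _ => ?_).trans_eq (by simp)
    rw [← Finset.sum_sub_distrib]
    refine Finset.sum_le_sum fun t ht => ?_
    have ht1 := (Finset.mem_Icc.1 ht).1
    exact globalLoss_sub_le H.cvx H.n_pos H.G₁_nonneg ht1 (hxX t ht1) y i
  -- one-step inequalities
  have h2 : ∀ t ∈ Finset.Icc 1 T, ∑ i, (M.f i t (x t i) - M.f i t y +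
      κ * (γ₀ / rate c t * M.viol t i (x t i) ^ 2) - ν t i - rate c t * A -
        V * M.viol t i (x t i)) ≤ (Z t - Z (t + 1)) / (2 * rate c t) := by
    intro t ht
    have ht1 := (Finset.mem_Icc.1 ht).1
    refine le_trans (Finset.sum_le_sum fun i _ => ?_) (H.sum_one_step hz₁ u ht1 hy.1)
    have h3 := inner_clip_le le_rfl (M.g i t (x t i)) (M.g i t y)
      (fun k => by rw [neg_zero]; exact hy.2 t ht ⟨i, k⟩)
    rw [neg_zero, zero_mul] at h3
    have h4 : γ₀ / rate c t * inner ℝ (clip (M.g i t (x t i))) (M.g i t y) ≤ 0 :=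
      mul_nonpos_of_nonneg_of_nonpos (div_nonneg hγ.le (rate_pos ht1).le) h3
    linarith
  have h3 := (Finset.sum_le_sum h2).trans (sum_sub_div_rate_le H.c_mem.1.le
    (fun t _ => Finset.sum_nonneg fun i _ => sq_nonneg ‖z t i - y‖)
    (fun t ht => H.sum_dist_mem hz₁ u ht hy.1) hT)
  have h4 := mul_le_mul_of_nonneg_left (H.sum_spread_xIter_le hz₁ u T) H.G₁_nonneg
  rw [← hCW, ← hx] at h4
  have h5 : ∑ t ∈ Finset.Icc 1 T, ∑ i, (1 / (n : ℝ) * (M.f i t (x t i) - M.f i t y +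
      κ * (γ₀ / rate c t * M.viol t i (x t i) ^ 2) - ν t i - rate c t * A -
        V * M.viol t i (x t i))) ≤ (2 * R) ^ 2 / 2 * (T : ℝ) ^ c := by
    simp_rw [← Finset.mul_sum]
    rw [one_div, inv_mul_le_iff₀ hn]
    linarith
  have h6 : G₁ * ∑ t ∈ Finset.Icc 1 T, spread (x t) ≤
      ∑ t ∈ Finset.Icc 1 T, ∑ i, G₁ * (CW * (p * G₁ * rate c t +
        2 * p * G₂ * γ₀ * M.viol t i (x t i))) := by
    simp_rw [← Finset.mul_sum]; exact h4
  set Q := regretRate n p r R G₁ G₂ w B γ₀ with hQ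
  -- Termwise, the remaining penalty absorbs the linear violation terms of the estimator and of the
  -- consensus error together; `Q` collects the resulting coefficients of `α_t`.
  have h7 : ∑ t ∈ Finset.Icc 1 T, ∑ i, (1 / (n : ℝ) * (M.f i t (x t i) - M.f i t y)) +
      ∑ t ∈ Finset.Icc 1 T, ∑ i, G₁ * (CW * (p * G₁ * rate c t +
        2 * p * G₂ * γ₀ * M.viol t i (x t i))) ≤
      ∑ t ∈ Finset.Icc 1 T, ∑ i, (1 / (n : ℝ) * (M.f i t (x t i) - M.f i t y +
        κ * (γ₀ / rate c t * M.viol t i (x t i) ^ 2) - ν t i - rate c t * A -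
        V * M.viol t i (x t i))) + ∑ t ∈ Finset.Icc 1 T, ∑ i, 1 / (n : ℝ) * ν t i +
      ∑ t ∈ Finset.Icc 1 T, ∑ i : Fin n, Q * rate c t := by
    simp_rw [← Finset.sum_add_distrib]
    refine Finset.sum_le_sum fun t ht => Finset.sum_le_sum fun i _ => ?_
    have hα := rate_pos (c := c) (Finset.mem_Icc.1 ht).1
    have hq := linear_le_quadratic (β := V / n + G₁ * (CW * (2 * p * G₂ * γ₀)))
      (k := κ * γ₀ / n) (e := M.viol t i (x t i)) (by positivity) hα
    have e1 : 1 / (n : ℝ) * (κ * (γ₀ / rate c t * M.viol t i (x t i) ^ 2)) =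
      κ * γ₀ / n / rate c t * M.viol t i (x t i) ^ 2 := by field_simp
    rw [hQ, regretRate]
    have e2 : 1 / (n : ℝ) * (M.f i t (x t i) - M.f i t y +
        κ * (γ₀ / rate c t * M.viol t i (x t i) ^ 2) - ν t i - rate c t * A -
        V * M.viol t i (x t i)) = 1 / (n : ℝ) * (M.f i t (x t i) - M.f i t y) +
        κ * γ₀ / n / rate c t * M.viol t i (x t i) ^ 2 - 1 / (n : ℝ) * ν t i -
        A / n * rate c t - V / n * M.viol t i (x t i) := by
      rw [← e1]; ring
    rw [e2]
    linarith
  rw [sum_const_mul_rate] at h7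
  have hV0 : 0 ≤ A := by
    have := H.G₁_nonneg; have := H.R_nonneg; have := H.r_pos
    simp only [A, constA]; positivity
  have hQ0 : 0 ≤ Q := by
    have := H.G₁_nonneg; have := consensusConst_nonneg n w B
    rw [hQ, regretRate]; positivity
  have h8 : n * Q * ∑ t ∈ Finset.Icc 1 T, rate c t ≤
      n * Q / (1 - c) * (T : ℝ) ^ max c (1 - c) := by
    calc n * Q * ∑ t ∈ Finset.Icc 1 T, rate c t
        ≤ n * Q * ((T : ℝ) ^ max c (1 - c) / (1 - c)) := by
          refine mul_le_mul_of_nonneg_left ((sum_rate_le H.c_mem T).trans ?_) (by positivity)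
          have := Real.rpow_le_rpow_of_exponent_le hT' (le_max_right c (1 - c))
          gcongr
      _ = _ := by ring
  have h9 : (2 * R) ^ 2 / 2 * (T : ℝ) ^ c ≤ (2 * R) ^ 2 / 2 * (T : ℝ) ^ max c (1 - c) := by
    have := Real.rpow_le_rpow_of_exponent_le hT' (le_max_left c (1 - c))
    gcongr
  refine h1.trans ?_
  rw [Finset.sum_add_distrib, ← Finset.mul_sum, regretConst, add_mul]
  linarith

/-- After multiplication by `α_t` the weight `γ_t α_t` is the constant `γ₀`, the telescope is
bounded, and the Slater margin gives `ςγ₀` times the local violation. The loss difference is only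
bounded by `2F`, which suffices because it now carries the factor `α_t`. -/
theorem ccv_path_le (H : M.Standing r R G₁ G₂ w B c γ₀) {z₁ : Fin n → Euc p}
    (hz₁ : ∀ i, z₁ i ∈ M.shrunk c 1) (u : ℕ → Fin n → UnitSphere p) {T : ℕ} (hT : 1 ≤ T)
    {F ς : ℝ} (hF : M.LossBounded F) (hς : 0 < ς)
    {y : Euc p} (hy : y ∈ M.X) (hys : ∀ t, 1 ≤ t → ∀ k, M.globalConstraint t y k ≤ -ς) :
    M.netCCV (M.xIter (powerParams c γ₀ r) z₁ u) T ≤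
      ccvConst n p r R G₁ G₂ w B c γ₀ F ς * (T : ℝ) ^ (1 - c) +
        ∑ t ∈ Finset.Icc 1 T, ∑ i, violFactor n p G₂ w B γ₀ * (1 / (ς * γ₀)) * rate c t *
          M.noise (powerParams c γ₀ r) G₁ G₂ t i y
            (M.xIter (powerParams c γ₀ r) z₁ u t i) (u t i) := by
  have hn : (0 : ℝ) < n := by exact_mod_cast H.n_pos
  have hT' : (1 : ℝ) ≤ T := by exact_mod_cast hT
  have hc1 : 0 < 1 - c := by linarith [H.c_mem.2]
  set x := M.xIter (powerParams c γ₀ r) z₁ u with hx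
  set z := M.zIter (powerParams c γ₀ r) z₁ u with hz
  have hxX : ∀ t, 1 ≤ t → ∀ i, x t i ∈ M.X := fun t ht i => H.xIter_mem_X hz₁ u ht i
  set Z : ℕ → ℝ := fun t => ∑ i, ‖z t i - y‖ ^ 2 with hZ
  set κ : ℝ := 1 / ((p : ℝ) ^ 2 + 1) with hκ
  have hκ0 : 0 < κ := by positivity
  have hγ := H.γ_pos
  have hG₁ := H.G₁_nonneg
  have hG₂ := H.G₂_nonneg
  set ν : ℕ → Fin n → ℝ := fun t i => M.noise (powerParams c γ₀ r) G₁ G₂ t i y (x t i) (u t i)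
    with hν
  set CW := consensusConst n w B with hCW
  have hCW0 : 0 ≤ CW := consensusConst_nonneg n w B
  set A := constA p r R G₁ with hA
  set V := constV p r R G₂ γ₀ with hV
  set S := ∑ t ∈ Finset.Icc 1 T, rate c t with hS
  set E := ∑ t ∈ Finset.Icc 1 T, ∑ i, M.viol t i (x t i) with hE
  have h1 : M.netCCV x T ≤ E + n * (2 * G₂ * ∑ t ∈ Finset.Icc 1 T, spread (x t)) := by
    rw [netCCV, one_div, inv_mul_le_iff₀ hn]
    refine (Finset.sum_le_card_nsmul _ _
      (E + n * (2 * G₂ * ∑ t ∈ Finset.Icc 1 T, spread (x t))) fun i _ => ?_).trans_eq (by simp; ring)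
    rw [hE, Finset.mul_sum, Finset.mul_sum, ← Finset.sum_add_distrib]
    refine Finset.sum_le_sum fun t ht => ?_
    have ht1 := (Finset.mem_Icc.1 ht).1
    exact norm_clip_globalConstraint_le H.cvx hG₂ ht1 (hxX t ht1) i
  have h2 : ∑ t ∈ Finset.Icc 1 T, spread (x t) ≤
      CW * (n * (p * G₁) * S + 2 * p * G₂ * γ₀ * E) := by
    refine (H.sum_spread_xIter_le hz₁ u T).trans_eq ?_
    simp_rw [Finset.sum_add_distrib]
    rw [sum_const_mul_rate]
    simp_rw [← Finset.mul_sum]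
    rfl
  have h3 : ∀ t ∈ Finset.Icc 1 T, ∑ i, (ς * γ₀ * M.viol t i (x t i) - rate c t * ν t i -
      violRate p r R G₁ G₂ γ₀ F * rate c t) ≤ (Z t - Z (t + 1)) / 2 := by
    intro t ht
    have ht1 := (Finset.mem_Icc.1 ht).1
    have hα := rate_pos (c := c) ht1
    have hα1 := rate_le_one H.c_mem.1.le ht1
    have h4 := mul_le_mul_of_nonneg_left (H.sum_one_step hz₁ u ht1 hy) hα.le
    have e1 : rate c t * ((Z t - Z (t + 1)) / (2 * rate c t)) = (Z t - Z (t + 1)) / 2 := by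
      field_simp
    rw [← e1]
    refine le_trans ?_ h4
    rw [Finset.mul_sum]
    refine Finset.sum_le_sum fun i _ => ?_
    rw [← hx]
    change _ ≤ rate c t * (_ - ν t i - _ - _)
    set α := rate c t
    set e := M.viol t i (x t i) with he
    have h5 := inner_clip_le hς.le (M.g i t (x t i)) (M.g i t y) (fun k => hys t ht1 ⟨i, k⟩)
    have h6 : γ₀ * inner ℝ (clip (M.g i t (x t i))) (M.g i t y) ≤ γ₀ * (-ς * e) :=
      mul_le_mul_of_nonneg_left h5 hγ.le
    have h7 := linear_le_quadratic (β := V) (k := κ * γ₀) (α := α) (e := e) (by positivity) hα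
    have h8 := abs_le.1 (hF i t ht1 _ (hxX t ht1 i))
    have h9 := abs_le.1 (hF i t ht1 _ hy)
    have h10 : -(2 * F) ≤ M.f i t (x t i) - M.f i t y := by linarith
    have h11 := mul_le_mul_of_nonneg_left h10 hα.le
    have h12 : α * (V * e) ≤ κ * γ₀ * e ^ 2 + α * (α * (V ^ 2 / (4 * (κ * γ₀)))) := by
      have := mul_le_mul_of_nonneg_left h7 hα.le
      have e2 : α * (κ * γ₀ / α * e ^ 2 + α * (V ^ 2 / (4 * (κ * γ₀)))) =
        κ * γ₀ * e ^ 2 + α * (α * (V ^ 2 / (4 * (κ * γ₀)))) := by field_simp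
      linarith
    have h13 : α * (α * (V ^ 2 / (4 * (κ * γ₀)))) ≤ α * (1 * (V ^ 2 / (4 * (κ * γ₀)))) := by
      gcongr
    have hA0 : 0 ≤ A := by
      have := H.R_nonneg; have := H.r_pos
      rw [hA, constA]; positivity
    have h14 : α * (α * A) ≤ α * (1 * A) := by gcongr
    have e3 : α * (M.f i t (x t i) - M.f i t y -
        γ₀ / α * inner ℝ (clip (M.g i t (x t i))) (M.g i t y) + κ * (γ₀ / α * e ^ 2) - ν t i -
        α * A - V * e) = α * (M.f i t (x t i) - M.f i t y) -
        γ₀ * inner ℝ (clip (M.g i t (x t i))) (M.g i t y) + κ * γ₀ * e ^ 2 - α * ν t i -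
        α * (α * A) - α * (V * e) := by field_simp
    rw [e3, violRate]
    linarith
  have h4 : ∑ t ∈ Finset.Icc 1 T, (Z t - Z (t + 1)) / 2 ≤ n * (2 * R) ^ 2 / 2 := by
    rw [← Finset.sum_div]
    have e1 : ∑ t ∈ Finset.Icc 1 T, (Z t - Z (t + 1)) = Z 1 - Z (T + 1) := by
      rw [sum_Icc_one_eq, Finset.sum_range_sub' (fun t => Z (t + 1))]
    have h5 : 0 ≤ Z (T + 1) := Finset.sum_nonneg fun i _ => sq_nonneg _
    have h6 : Z 1 ≤ n * (2 * R) ^ 2 := H.sum_dist_mem hz₁ u le_rfl hy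
    rw [e1]
    linarith
  have h5 := (Finset.sum_le_sum h3).trans h4
  simp_rw [Finset.sum_sub_distrib] at h5
  rw [sum_const_mul_rate] at h5
  simp_rw [← Finset.mul_sum] at h5
  rw [← hE, ← hS] at h5
  set N := ∑ t ∈ Finset.Icc 1 T, rate c t * ∑ i, ν t i with hN
  set VR := violRate p r R G₁ G₂ γ₀ F with hVR
  have hF0 : 0 ≤ F := (abs_nonneg _).trans (hF ⟨0, H.n_pos⟩ 1 le_rfl y hy)
  have hVR0 : 0 ≤ VR := by
    have := H.R_nonneg; have := H.r_pos
    rw [hVR, violRate, constA]; positivity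
  have hT1 : 1 ≤ (T : ℝ) ^ (1 - c) := Real.one_le_rpow hT' hc1.le
  have hSle : S ≤ (T : ℝ) ^ (1 - c) / (1 - c) := sum_rate_le H.c_mem T
  set vf := violFactor n p G₂ w B γ₀ with hvf
  have hvf0 : 0 ≤ vf := by rw [hvf, violFactor]; positivity
  have h6 : E ≤ 1 / (ς * γ₀) * ((n * (2 * R) ^ 2 / 2 + n * VR / (1 - c)) * (T : ℝ) ^ (1 - c) + N) := by
    rw [one_div, le_inv_mul_iff₀ (by positivity)]
    have h7 : n * VR * S ≤ n * VR * ((T : ℝ) ^ (1 - c) / (1 - c)) := by gcongr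
    have h8 : n * (2 * R) ^ 2 / 2 * 1 ≤ n * (2 * R) ^ 2 / 2 * (T : ℝ) ^ (1 - c) := by gcongr
    have e1 : n * VR * ((T : ℝ) ^ (1 - c) / (1 - c)) = n * VR / (1 - c) * (T : ℝ) ^ (1 - c) := by
      ring
    linarith
  -- The consensus error itself contains the local violation `E`; the factor `vf` collects both
  -- contributions.
  have h7 : M.netCCV x T ≤ vf * E + n * (2 * G₂ * (CW * (n * (p * G₁)))) * S := by
    have h8 : n * (2 * G₂ * ∑ t ∈ Finset.Icc 1 T, spread (x t)) ≤
        n * (2 * G₂ * (CW * (n * (p * G₁) * S + 2 * p * G₂ * γ₀ * E))) := by gcongr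
    refine h1.trans ((add_le_add_right h8 E).trans_eq ?_)
    rw [hvf, violFactor]
    ring
  have h8 : n * (2 * G₂ * (CW * (n * (p * G₁)))) * S ≤
      n * (2 * G₂ * (CW * (n * (p * G₁)))) * ((T : ℝ) ^ (1 - c) / (1 - c)) := by gcongr
  have h9 := mul_le_mul_of_nonneg_left h6 hvf0
  have e1 : ∑ t ∈ Finset.Icc 1 T, ∑ i, vf * (1 / (ς * γ₀)) * rate c t * ν t i =
      vf * (1 / (ς * γ₀)) * N := by
    rw [hN, Finset.mul_sum]
    refine Finset.sum_congr rfl fun t _ => ?_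
    rw [Finset.mul_sum, Finset.mul_sum]
    exact Finset.sum_congr rfl fun i _ => by ring
  rw [e1, ccvConst, ← hvf, ← hCW, ← hVR]
  refine h7.trans ((add_le_add h9 h8).trans_eq ?_)
  ring

end Standing
end Problem
end DistBandit

/-! ### Continuity of the iterates in the exploration directions. -/

namespace DistBandit

theorem continuous_clip {ι : Type} [Fintype ι] : Continuous (clip : EuclideanSpace ℝ ι → _) := by
  unfold clip
  fun_prop

namespace Problem
variable {n p : ℕ}

/-- Causality of the algorithm, from which independence of the current direction will follow. -/
theorem zIter_congr (M : Problem n p) (a : Params) (z₁ : Fin n → Euc p)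
    {u u' : ℕ → Fin n → UnitSphere p} {t : ℕ} (h : ∀ s, 1 ≤ s → s < t → u s = u' s) :
    M.zIter a z₁ u t = M.zIter a z₁ u' t := by
  induction t with
  | zero => rfl
  | succ t ih =>
    rcases Nat.eq_zero_or_pos t with rfl | ht
    · rfl
    · rw [zIter_succ a z₁ u ht, zIter_succ a z₁ u' ht, ih fun s h1 h2 => h s h1 (by omega),
        h t ht (Nat.lt_succ_self t)]

theorem xIter_congr (M : Problem n p) (a : Params) (z₁ : Fin n → Euc p)
    {u u' : ℕ → Fin n → UnitSphere p} {t : ℕ} (h : ∀ s, 1 ≤ s → s < t → u s = u' s) :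
    M.xIter a z₁ u t = M.xIter a z₁ u' t := by
  rw [xIter, xIter, M.zIter_congr a z₁ h]

/-- The problem whose losses and constraints are precomposed with the projection onto `X`. -/
noncomputable def extend (M : Problem n p) : Problem n p where
  X := M.X
  m := M.m
  f i t x := M.f i t (metricProj M.X x)
  g i t x := M.g i t (metricProj M.X x)
  edges := M.edges
  W := M.W

variable {M : Problem n p} {r R G₁ G₂ w c γ₀ : ℝ} {B : ℕ}

namespace Standing
variable (H : M.Standing r R G₁ G₂ w B c γ₀)
include H

theorem extend_g (i : Fin n) (t : ℕ) {x : Euc p} (hx : x ∈ M.X) :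
    M.extend.g i t x = M.g i t x := by
  change M.g i t (metricProj M.X x) = _
  rw [metricProj_of_mem H.set.closed H.set.convex hx]

theorem continuous_metricProj : Continuous (metricProj M.X) :=
  (lipschitzWith_metricProj ⟨0, H.set.zero_mem H.r_pos⟩ H.set.closed H.set.convex).continuous

theorem metricProj_mem_X (x : Euc p) : metricProj M.X x ∈ M.X :=
  metricProj_mem ⟨0, H.set.zero_mem H.r_pos⟩ H.set.closed H.set.convex x

theorem continuousOn_f {i : Fin n} {t : ℕ} (ht : 1 ≤ t) : ContinuousOn (M.f i t) M.X := by
  refine (LipschitzOnWith.of_dist_le_mul (K := Real.toNNReal G₁) fun x hx y hy => ?_).continuousOn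
  rw [Real.dist_eq, dist_eq_norm, Real.coe_toNNReal _ H.G₁_nonneg]
  exact H.cvx.abs_f_sub_le ht hx hy

theorem continuousOn_g {i : Fin n} {t : ℕ} (ht : 1 ≤ t) : ContinuousOn (M.g i t) M.X := by
  have := H.G₂_nonneg
  refine (LipschitzOnWith.of_dist_le_mul (K := Real.toNNReal (2 * G₂))
    fun x hx y hy => ?_).continuousOn
  rw [dist_eq_norm, dist_eq_norm, Real.coe_toNNReal _ (by positivity)]
  exact H.cvx.norm_g_sub_le ht hx hy

theorem continuous_extend_f {i : Fin n} {t : ℕ} (ht : 1 ≤ t) : Continuous (M.extend.f i t) :=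
  (H.continuousOn_f ht).comp_continuous H.continuous_metricProj H.metricProj_mem_X

theorem continuous_extend_g {i : Fin n} {t : ℕ} (ht : 1 ≤ t) : Continuous (M.extend.g i t) :=
  (H.continuousOn_g ht).comp_continuous H.continuous_metricProj H.metricProj_mem_X

theorem extend_lagr (i : Fin n) (t : ℕ) (q : Euc (M.m i)) {x : Euc p} (hx : x ∈ M.X) :
    M.extend.lagr i t q x = M.lagr i t q x := by
  change M.f i t (metricProj M.X x) + inner ℝ q (M.g i t (metricProj M.X x)) = _
  rw [metricProj_of_mem H.set.closed H.set.convex hx]; rfl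

theorem extend_dual (a : Params) (i : Fin n) (t : ℕ) {x : Euc p} (hx : x ∈ M.X) :
    M.extend.dual a t i x = M.dual a t i x := by
  rw [dual, dual, H.extend_g i t hx]; rfl

theorem extend_direction {i : Fin n} {t : ℕ} (ht : 1 ≤ t) {x : Euc p} (hx : x ∈ M.shrunk c t)
    (u : UnitSphere p) :
    M.extend.direction (powerParams c γ₀ r) t i x u = M.direction (powerParams c γ₀ r) t i x u := by
  have hX := shrunk_subset H.set H.r_pos H.c_mem.1.le ht hx
  have h2 : x + (powerParams c γ₀ r).δ t • (u : Euc p) ∈ M.X :=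
    add_mem_of_mem_shrunk H.set H.r_pos H.c_mem.1.le ht hx (by simp)
  rw [direction_eq, direction_eq, gradEst, gradEst, H.extend_dual _ i t hX,
    H.extend_lagr i t _ hX, H.extend_lagr i t _ h2]

theorem extend_noise {i : Fin n} {t : ℕ} (ht : 1 ≤ t) {x y : Euc p} (hx : x ∈ M.shrunk c t)
    (hy : y ∈ M.X) (u : UnitSphere p) :
    M.extend.noise (powerParams c γ₀ r) G₁ G₂ t i y x u =
      M.noise (powerParams c γ₀ r) G₁ G₂ t i y x u := by
  have hX := shrunk_subset H.set H.r_pos H.c_mem.1.le ht hx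
  rw [noise, noise, H.extend_direction ht hx, H.extend_dual _ i t hX, H.extend_lagr i t _ hX,
    H.extend_lagr i t _ hy]
  rfl

variable {z₁ : Fin n → Euc p}

/-- The algorithm evaluates `f` and `g` inside `X` only, so values off `X` are irrelevant. The
extended functions are continuous on the whole space, and continuity of the iterates follows by
composition. -/
theorem extend_zIter (hz₁ : ∀ i, z₁ i ∈ M.shrunk c 1) (u : ℕ → Fin n → UnitSphere p) {t : ℕ}
    (ht : 1 ≤ t) :
    M.extend.zIter (powerParams c γ₀ r) z₁ u t = M.zIter (powerParams c γ₀ r) z₁ u t := by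
  induction t, ht using Nat.le_induction with
  | base => rfl
  | succ t ht ih =>
    rw [zIter_succ _ _ _ ht, zIter_succ _ _ _ ht, ih]
    funext i
    have hx := xIter_mem (γ₀ := γ₀) (u := u) H.set H.r_pos H.net hz₁ ht i
    have hd := H.extend_direction (i := i) ht hx (u t i)
    change metricProj _ (M.xIter (powerParams c γ₀ r) z₁ u t i - _ •
      M.extend.direction (powerParams c γ₀ r) t i (M.xIter (powerParams c γ₀ r) z₁ u t i) (u t i)) = _
    rw [hd]
    rfl

theorem extend_xIter (hz₁ : ∀ i, z₁ i ∈ M.shrunk c 1) (u : ℕ → Fin n → UnitSphere p) {t : ℕ}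
    (ht : 1 ≤ t) :
    M.extend.xIter (powerParams c γ₀ r) z₁ u t = M.xIter (powerParams c γ₀ r) z₁ u t := by
  rw [xIter, xIter, H.extend_zIter hz₁ u ht]; rfl

theorem continuous_extend_dual (a : Params) {i : Fin n} {t : ℕ} (ht : 1 ≤ t) :
    Continuous (M.extend.dual a t i) :=
  ((continuous_clip.comp (H.continuous_extend_g (i := i) ht)).const_smul (a.γ t) :)

theorem continuous_extend_lagr (a : Params) {i : Fin n} {t : ℕ} (ht : 1 ≤ t) {Y : Type*}
    [TopologicalSpace Y] {x y : Y → Euc p} (hx : Continuous x) (hy : Continuous y) :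
    Continuous fun ω => M.extend.lagr i t (M.extend.dual a t i (x ω)) (y ω) := by
  have h1 := (H.continuous_extend_f (i := i) ht).comp hy
  have h2 := (H.continuous_extend_g (i := i) ht).comp hy
  have h3 := (H.continuous_extend_dual a (i := i) ht).comp hx
  exact h1.add (h3.inner h2)

theorem continuous_extend_direction (a : Params) {i : Fin n} {t : ℕ} (ht : 1 ≤ t) {Y : Type*}
    [TopologicalSpace Y] {x u : Y → Euc p} (hx : Continuous x) (hu : Continuous u) :
    Continuous fun ω => M.extend.direction a t i (x ω) (u ω) := by
  simp_rw [direction_eq, gradEst]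
  have h1 := H.continuous_extend_lagr a (i := i) ht hx (hx.add (hu.const_smul (a.δ t)))
  have h2 := H.continuous_extend_lagr a (i := i) ht hx hx
  exact (continuous_const.mul (h1.sub h2)).smul hu

theorem continuous_extend_noise (a : Params) {i : Fin n} {t : ℕ} (ht : 1 ≤ t) (y : Euc p)
    {Y : Type*} [TopologicalSpace Y] {x u : Y → Euc p} (hx : Continuous x) (hu : Continuous u) :
    Continuous fun ω => M.extend.noise a G₁ G₂ t i y (x ω) (u ω) := by
  have h1 := H.continuous_extend_lagr a (i := i) ht hx hx
  have h2 := H.continuous_extend_lagr a (i := i) ht hx (continuous_const (y := y))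
  have h3 := H.continuous_extend_direction a (i := i) ht hx hu
  have h4 := ((H.continuous_extend_dual a (i := i) ht).comp hx).norm
  unfold noise
  exact ((h1.sub h2).sub (((h4.const_mul (2 * G₂)).const_add G₁).mul_const (a.δ t) |>.const_mul 2)).sub
    (h3.inner (hx.sub continuous_const))

theorem continuous_extend_zIter {t : ℕ} (ht : 1 ≤ t) :
    Continuous fun u : ℕ → Fin n → UnitSphere p =>
      M.extend.zIter (powerParams c γ₀ r) z₁ u t := by
  induction t, ht using Nat.le_induction with
  | base => exact continuous_const
  | succ t ht ih =>
    simp_rw [zIter_succ _ _ _ ht]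
    refine continuous_pi fun i => ?_
    have hmix : Continuous fun u : ℕ → Fin n → UnitSphere p =>
        M.extend.mix t (M.extend.zIter (powerParams c γ₀ r) z₁ u t) i := by
      unfold mix
      exact continuous_finsetSum _ fun j _ =>
        (((continuous_apply j).comp ih).const_smul (M.W t i j) :)
    have hu : Continuous fun u : ℕ → Fin n → UnitSphere p => ((u t i : UnitSphere p) : Euc p) :=
      continuous_subtype_val.comp ((continuous_apply i).comp (continuous_apply t))
    have hd := H.continuous_extend_direction (powerParams c γ₀ r) (i := i) ht hmix hu
    exact (lipschitzWith_metricProj ⟨0, zero_mem_shrunk (c := c) (t := t + 1) H.set H.r_pos⟩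
      (isClosed_shrunk H.set) (convex_shrunk H.set)).continuous.comp 
        (hmix.sub (hd.const_smul (rate c t) :))

theorem continuous_xIter (hz₁ : ∀ i, z₁ i ∈ M.shrunk c 1) {t : ℕ} (ht : 1 ≤ t) (i : Fin n) :
    Continuous fun u : ℕ → Fin n → UnitSphere p => M.xIter (powerParams c γ₀ r) z₁ u t i := by
  simp_rw [← H.extend_xIter hz₁ _ ht]
  unfold xIter mix
  exact continuous_finsetSum _ fun j _ =>
    (((continuous_apply j).comp (H.continuous_extend_zIter (z₁ := z₁) ht)).const_smul (M.W t i j) :)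

theorem continuous_noise (hz₁ : ∀ i, z₁ i ∈ M.shrunk c 1) {t : ℕ} (ht : 1 ≤ t) (i : Fin n)
    {y : Euc p} (hy : y ∈ M.X) :
    Continuous fun u : ℕ → Fin n → UnitSphere p => M.noise (powerParams c γ₀ r) G₁ G₂ t i y
      (M.xIter (powerParams c γ₀ r) z₁ u t i) (u t i) := by
  simp_rw [← H.extend_noise ht (xIter_mem H.set H.r_pos H.net hz₁ ht i) hy]
  exact H.continuous_extend_noise _ ht y (H.continuous_xIter hz₁ ht i)
    (continuous_subtype_val.comp ((continuous_apply i).comp (continuous_apply t)))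

theorem continuous_netReg (hz₁ : ∀ i, z₁ i ∈ M.shrunk c 1) (T : ℕ) :
    Continuous fun u : ℕ → Fin n → UnitSphere p =>
      M.netReg (M.xIter (powerParams c γ₀ r) z₁ u) T := by
  unfold netReg globalLoss
  refine (continuous_finsetSum _ fun i _ => Continuous.sub (continuous_finsetSum _ fun t ht =>
    (continuous_finsetSum _ fun j _ => ?_).const_mul _) continuous_const).const_mul _
  have ht1 := (Finset.mem_Icc.1 ht).1
  exact (H.continuousOn_f ht1).comp_continuous (H.continuous_xIter hz₁ ht1 i)
    fun u => H.xIter_mem_X hz₁ u ht1 i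

theorem continuous_netCCV (hz₁ : ∀ i, z₁ i ∈ M.shrunk c 1) (T : ℕ) :
    Continuous fun u : ℕ → Fin n → UnitSphere p =>
      M.netCCV (M.xIter (powerParams c γ₀ r) z₁ u) T := by
  unfold netCCV
  refine (continuous_finsetSum _ fun i _ => continuous_finsetSum _ fun t ht => ?_).const_mul _
  have ht1 := (Finset.mem_Icc.1 ht).1
  refine (continuous_clip.comp ?_).norm
  refine (PiLp.continuous_toLp 2 _).comp (continuous_pi fun k => ?_)
  have h := (H.continuousOn_g (i := k.1) ht1).comp_continuous (H.continuous_xIter hz₁ ht1 i)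
    fun u => H.xIter_mem_X hz₁ u ht1 i
  exact (PiLp.continuous_apply 2 _ k.2).comp h

/-- The multiplier depends on `x` only and stays fixed while `u` varies. Being nonnegative it keeps
the Lagrangian convex, so `gradEst_lower_bound` applies with the Lipschitz constant occurring in
`noise`. -/
theorem integral_noise_sphere_nonpos {t : ℕ} (ht : 1 ≤ t) (i : Fin n) {x y : Euc p}
    (hx : x ∈ M.shrunk c t) (hy : y ∈ M.X) :
    ∫ u : UnitSphere p, M.extend.noise (powerParams c γ₀ r) G₁ G₂ t i y x u ∂uniformSphere p ≤
      0 := by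
  have := isProbabilityMeasure_uniformSphere H.p_pos
  have hX := shrunk_subset H.set H.r_pos H.c_mem.1.le ht hx
  have hα := rate_pos (c := c) ht
  have hγ0 : 0 ≤ (powerParams c γ₀ r).γ t := div_nonneg H.γ_pos.le hα.le
  have hδ0 : 0 < (powerParams c γ₀ r).δ t := mul_pos H.r_pos hα
  have hG₁ := H.G₁_nonneg
  have hG₂ := H.G₂_nonneg
  have hint : Integrable (fun u : UnitSphere p =>
      inner ℝ (M.direction (powerParams c γ₀ r) t i x u) (x - y)) (uniformSphere p) := by
    simp_rw [← H.extend_direction ht hx]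
    exact ((H.continuous_extend_direction _ ht continuous_const
      continuous_subtype_val).inner continuous_const).integrable_of_hasCompactSupport
        (HasCompactSupport.of_compactSpace _)
  simp_rw [H.extend_noise ht hx hy, noise]
  rw [integral_sub (integrable_const _) hint, integral_const, probReal_univ, one_smul]
  have key := gradEst_lower_bound H.p_pos H.set.closed H.set.convex
    (H.cvx.convexOn_lagr ht (dual_nonneg hγ0 i x))
    (by positivity : 0 ≤ G₁ + 2 * G₂ * ‖M.dual (powerParams c γ₀ r) t i x‖)
    (fun a ha b hb => H.cvx.abs_lagr_sub_le ht _ ha hb) hδ0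
    (fun v hv => add_mem_of_mem_shrunk H.set H.r_pos H.c_mem.1.le ht hx hv) hy
  simp_rw [← direction_eq] at key
  linarith

end Standing
end Problem
end DistBandit

/-! ### Independence and the mean of the noise. -/

namespace DistBandit

/-- It is applied to the compact product of all exploration spheres, where continuity gives
boundedness and hence integrability. -/
theorem integrable_comp_of_continuous {Y Ω : Type*} [TopologicalSpace Y] [CompactSpace Y]
    [MeasurableSpace Y] [OpensMeasurableSpace Y] [MeasurableSpace Ω] {P : Measure Ω}
    [IsFiniteMeasure P] {Φ : Y → ℝ} (hΦ : Continuous Φ) {V : Ω → Y} (hV : Measurable V) :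
    Integrable (fun ω => Φ (V ω)) P := by
  obtain ⟨C, hC⟩ := isCompact_univ.exists_bound_of_continuousOn hΦ.continuousOn
  exact Integrable.of_bound (hΦ.measurable.comp hV).aestronglyMeasurable C
    (Filter.Eventually.of_forall fun ω => hC _ (Set.mem_univ _))

namespace IsExploration
variable {Ω : Type*} {n p : ℕ} {U : ℕ → Fin n → Ω → UnitSphere p}

/-- The exploration directions with the placeholder at time `0` replaced. -/
def shifted (U : ℕ → Fin n → Ω → UnitSphere p) (ω : Ω) (s : ℕ) (j : Fin n) : UnitSphere p :=
  U (max s 1) j ω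

theorem shifted_eq {s : ℕ} (hs : 1 ≤ s) (ω : Ω) : shifted U ω s = fun j => U s j ω := by
  funext j
  rw [shifted, max_eq_left hs]

/-- The directions before time `t`, as an index set. -/
def past (n t : ℕ) (ht : 0 < t) : Finset (ℕ+ × Fin n) :=
  Finset.Iio (⟨t, ht⟩ : ℕ+) ×ˢ Finset.univ

open Classical in
/-- The family of directions that agrees with `v` before time `t` and is constant afterwards. -/
noncomputable def fill {t : ℕ} {ht : 0 < t} (u₀ : UnitSphere p) (v : past n t ht → UnitSphere p)
    (s : ℕ) (j : Fin n) : UnitSphere p :=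
  if h : ∃ hs : 0 < s, ((⟨s, hs⟩ : ℕ+), j) ∈ past n t ht then v ⟨(⟨s, h.1⟩, j), h.2⟩ else u₀

theorem continuous_fill {t : ℕ} {ht : 0 < t} (u₀ : UnitSphere p) :
    Continuous (fill u₀ : (past n t ht → UnitSphere p) → ℕ → Fin n → UnitSphere p) := by
  refine continuous_pi fun s => continuous_pi fun j => ?_
  unfold fill
  by_cases h : ∃ hs : 0 < s, ((⟨s, hs⟩ : ℕ+), j) ∈ past n t ht
  · simp only [h, ↓reduceDIte]
    exact continuous_apply _
  · simp only [h, ↓reduceDIte]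
    exact continuous_const

theorem fill_eq {t : ℕ} {ht : 0 < t} (u₀ : UnitSphere p) (ω : Ω) {s : ℕ} (hs : 1 ≤ s)
    (hst : s < t) :
    fill u₀ (fun k : past n t ht => U k.1.1 k.1.2 ω) s = shifted U ω s := by
  rw [shifted_eq hs]
  funext j
  have h : ∃ hs : 0 < s, ((⟨s, hs⟩ : ℕ+), j) ∈ past n t ht :=
    ⟨hs, Finset.mem_product.2 ⟨Finset.mem_Iio.2 (by exact_mod_cast hst), Finset.mem_univ _⟩⟩
  rw [fill, dif_pos h]
  rfl

variable [MeasurableSpace Ω] {P : Measure Ω}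

/-- `IsExploration` says nothing about time `0`, where `U` may fail to be measurable; this is why
the placeholder is replaced. -/
theorem measurable_shifted (hU : IsExploration P U) : Measurable (shifted U) :=
  measurable_pi_lambda _ fun s => measurable_pi_lambda _ fun j =>
    hU.measurable (max s 1) (le_max_right _ _) j

/-- A function of the directions before time `t` is independent of the directions at time `t`. -/
theorem indepFun_of_past (hU : IsExploration P U) {t : ℕ} (ht : 1 ≤ t) (i : Fin n) {E : Type*}
    [TopologicalSpace E] [MeasurableSpace E] [BorelSpace E]
    {Φ : (ℕ → Fin n → UnitSphere p) → E} (hΦ : Continuous Φ)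
    (hloc : ∀ u u', (∀ s, 1 ≤ s → s < t → u s = u' s) → Φ u = Φ u') (u₀ : UnitSphere p) :
    IndepFun (fun ω => Φ (shifted U ω)) (U t i) P := by
  set k : ℕ+ × Fin n := (⟨t, ht⟩, i)
  have hdis : Disjoint (past n t ht) {k} := by
    refine Finset.disjoint_singleton_right.2 fun hm => ?_
    exact lt_irrefl _ (Finset.mem_Iio.1 (Finset.mem_product.1 hm).1)
  have h1 := hU.indep.indepFun_finset _ _ hdis (fun k => hU.measurable k.1 k.1.2 k.2)
  have hk : k ∈ ({k} : Finset (ℕ+ × Fin n)) := Finset.mem_singleton_self _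
  -- Independence is available for finite families, while `Φ` takes whole sequences. `fill`
  -- completes the past by a constant that `Φ` does not see, by `hloc`.
  have hm1 : Measurable fun v : past n t ht → UnitSphere p => Φ (fill u₀ v) :=
    (hΦ.comp (continuous_fill u₀)).measurable
  have hm2 : Measurable fun v : ({k} : Finset (ℕ+ × Fin n)) → UnitSphere p => v ⟨k, hk⟩ :=
    measurable_pi_apply _
  have h2 := h1.comp hm1 hm2
  have e : (fun ω => Φ (shifted U ω)) =
      fun ω => Φ (fill u₀ fun k : past n t ht => U k.1.1 k.1.2 ω) := by
    funext ω
    exact hloc _ _ fun s hs hst => (fill_eq u₀ ω hs hst).symm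
  rw [e]
  exact h2

/-- The decision is a function of earlier directions, so its joint law with the current direction is
a product, and Fubini reduces the claim to the sphere integral at a fixed point of the shrunken set.
The extended noise serves as integrand because it is continuous on the whole product space. -/
theorem integral_noise_nonpos [IsProbabilityMeasure P] (hU : IsExploration P U)
    {M : Problem n p} {r R G₁ G₂ w c γ₀ : ℝ} {B : ℕ} (H : M.Standing r R G₁ G₂ w B c γ₀)
    {z₁ : Fin n → Euc p} (hz₁ : ∀ i, z₁ i ∈ M.shrunk c 1) {t : ℕ} (ht : 1 ≤ t) (i : Fin n)
    {y : Euc p} (hy : y ∈ M.X) :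
    ∫ ω, M.noise (powerParams c γ₀ r) G₁ G₂ t i y
      (M.xIter (powerParams c γ₀ r) z₁ (shifted U ω) t i) (shifted U ω t i) ∂P ≤ 0 := by
  have hmem : ∀ ω, M.xIter (powerParams c γ₀ r) z₁ (shifted U ω) t i ∈ M.shrunk c t := fun ω =>
    Problem.xIter_mem H.set H.r_pos H.net hz₁ ht i
  set X : Ω → Euc p := fun ω => M.xIter (powerParams c γ₀ r) z₁ (shifted U ω) t i with hX
  have hXc := H.continuous_xIter hz₁ ht i
  have hXm : Measurable X := hXc.measurable.comp hU.measurable_shifted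
  have hUm := hU.measurable t ht i
  obtain ⟨ω₀⟩ : Nonempty Ω := P.nonempty_of_neZero
  have hind : IndepFun X (U t i) P := hU.indepFun_of_past ht i hXc
    (fun u u' h => by rw [M.xIter_congr _ z₁ h]) (U t i ω₀)
  have hmap := (indepFun_iff_map_prod_eq_prod_map_map hXm.aemeasurable hUm.aemeasurable).1 hind
  rw [hU.law t ht i] at hmap
  have := isProbabilityMeasure_uniformSphere H.p_pos
  set Ψ : Euc p × UnitSphere p → ℝ :=
    fun q => M.extend.noise (powerParams c γ₀ r) G₁ G₂ t i y q.1 q.2 with hΨ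
  have hΨc : Continuous Ψ := H.continuous_extend_noise _ ht y continuous_fst
    (continuous_subtype_val.comp continuous_snd)
  have hpair : Measurable fun ω => (X ω, U t i ω) := hXm.prodMk hUm
  have e1 : ∀ ω, M.noise (powerParams c γ₀ r) G₁ G₂ t i y (X ω) (shifted U ω t i) =
      Ψ (X ω, U t i ω) := by
    intro ω
    rw [shifted_eq ht, hΨ, ← H.extend_noise ht (hmem ω) hy]
  have hint : Integrable (fun ω => Ψ (X ω, U t i ω)) P := by
    exact (integrable_comp_of_continuous (H.continuous_noise hz₁ ht i hy)
      hU.measurable_shifted).congr (Filter.Eventually.of_forall e1)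
  refine (integral_congr_ae (Filter.Eventually.of_forall e1)).trans_le ?_
  have hint' : Integrable Ψ ((P.map X).prod (uniformSphere p)) := by
    rw [← hmap]
    exact (integrable_map_measure hΨc.aestronglyMeasurable hpair.aemeasurable).2 hint
  rw [← integral_map hpair.aemeasurable hΨc.aestronglyMeasurable, hmap, integral_prod _ hint']
  refine integral_nonpos_of_ae ?_
  have hcl : MeasurableSet (M.shrunk c t) := (Problem.isClosed_shrunk H.set).measurableSet
  filter_upwards [(ae_map_iff hXm.aemeasurable hcl).2 (Filter.Eventually.of_forall hmem)] with x hx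
  exact H.integral_noise_sphere_nonpos ht i hx hy

end IsExploration

/-! ### Attainment of the offline optimum and passage to expectations. -/

namespace Problem.Standing
variable {n p : ℕ} {M : Problem n p} {r R G₁ G₂ w c γ₀ : ℝ} {B : ℕ}

theorem exists_offlineOpt (H : M.Standing r R G₁ G₂ w B c γ₀) {T : ℕ}
    (hne : (M.feasibleSet T).Nonempty) :
    ∃ y ∈ M.feasibleSet T, ∑ t ∈ Finset.Icc 1 T, M.globalLoss t y = M.offlineOpt T := by
  have hcont : ∀ t ∈ Finset.Icc 1 T, ContinuousOn (M.globalLoss t) M.X := by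
    intro t ht
    exact continuousOn_const.mul (continuousOn_finsetSum _ fun j _ =>
      H.continuousOn_f (Finset.mem_Icc.1 ht).1)
  have hcl : IsClosed (M.feasibleSet T) := by
    -- The constraints are known to be continuous on `X` only, so each sublevel set is intersected
    -- with `X` before its closedness is claimed.
    have e : M.feasibleSet T = M.X ∩ ⋂ t ∈ Finset.Icc 1 T, ⋂ k,
        (M.X ∩ (fun x => M.globalConstraint t x k) ⁻¹' Set.Iic 0) := by
      ext x
      simp only [feasibleSet, Set.mem_ofPred_eq, Set.mem_inter_iff, Set.mem_iInter,
        Set.mem_preimage, Set.mem_Iic]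
      exact ⟨fun h => ⟨h.1, fun t ht k => ⟨h.1, h.2 t ht k⟩⟩,
        fun h => ⟨h.1, fun t ht k => (h.2 t ht k).2⟩⟩
    rw [e]
    refine H.set.closed.inter (isClosed_biInter fun t ht => isClosed_iInter fun k => ?_)
    refine ContinuousOn.preimage_isClosed_of_isClosed ?_ H.set.closed isClosed_Iic
    exact (PiLp.continuous_apply 2 _ k.2).comp_continuousOn
      (H.continuousOn_g (i := k.1) (Finset.mem_Icc.1 ht).1)
  have hcomp : IsCompact (M.feasibleSet T) :=
    H.set.isCompact.of_isClosed_subset hcl fun x hx => hx.1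
  obtain ⟨y, hy, h⟩ := hcomp.exists_sInf_image_eq hne
    (f := fun x => ∑ t ∈ Finset.Icc 1 T, M.globalLoss t x)
    (continuousOn_finsetSum _ fun t ht => (hcont t ht).mono fun x hx => hx.1)
  exact ⟨y, hy, h.symm⟩

end Problem.Standing

/-- If a path is bounded by a constant plus a nonnegative combination of variables of nonpositive
mean, then its mean is bounded by the constant. -/
theorem integral_le_of_le_add_sum {Ω ι κ : Type*} [MeasurableSpace Ω] {P : Measure Ω}
    [IsProbabilityMeasure P] {s : Finset ι} [Fintype κ] {Y : Ω → ℝ} {K : ℝ} {a : ι → κ → ℝ}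
    {N : ι → κ → Ω → ℝ} (hY : Integrable Y P)
    (hN : ∀ t ∈ s, ∀ i, Integrable (N t i) P) (ha : ∀ t ∈ s, ∀ i, 0 ≤ a t i)
    (hN0 : ∀ t ∈ s, ∀ i, ∫ ω, N t i ω ∂P ≤ 0)
    (h : ∀ ω, Y ω ≤ K + ∑ t ∈ s, ∑ i, a t i * N t i ω) : ∫ ω, Y ω ∂P ≤ K := by
  have hs : ∀ t ∈ s, Integrable (fun ω => ∑ i, a t i * N t i ω) P := fun t ht =>
    integrable_finsetSum _ fun i _ => (hN t ht i).const_mul _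
  have hss : Integrable (fun ω => ∑ t ∈ s, ∑ i, a t i * N t i ω) P := integrable_finsetSum _ hs
  have h1 := integral_mono hY ((integrable_const K).add hss) h
  rw [integral_add' (integrable_const K) hss] at h1
  rw [integral_const, probReal_univ, one_smul, integral_finsetSum _ hs] at h1
  have h2 : ∑ t ∈ s, ∫ ω, ∑ i, a t i * N t i ω ∂P ≤ 0 := by
    refine Finset.sum_nonpos fun t ht => ?_
    rw [integral_finsetSum _ fun i _ => (hN t ht i).const_mul _]
    refine Finset.sum_nonpos fun i _ => ?_
    rw [integral_const_mul]
    exact mul_nonpos_of_nonneg_of_nonpos (ha t ht i) (hN0 t ht i)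
  linarith

end DistBandit

theorem theorem2 (n p : ℕ) (hn : 0 < n) (hp : 0 < p)
    (r R G₁ G₂ w : ℝ) (B : ℕ) (c γ₀ : ℝ)
    (hr : 0 < r) (hw : w ∈ Set.Ioo (0 : ℝ) 1) (hB : 0 < B) (hc : c ∈ Set.Ioo (0 : ℝ) 1)
    (hγ₀ : 0 < γ₀) (hγ₀' : 4 * ((p : ℝ) ^ 2 + 1) * G₂ ^ 2 * γ₀ ≤ 1) :
    ∃ C₁ : ℝ, ∀ F ς : ℝ, 0 < ς → ∃ C₂ : ℝ,
      ∀ M : Problem n p, (∀ i, 0 < M.m i) →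
        M.SetAssumption r R → M.LossBounded F → M.ConvexAssumption G₁ G₂ →
        M.NetworkAssumption w B → M.Slater ς →
      ∀ (Ω : Type*) [MeasurableSpace Ω] (P : Measure Ω) [IsProbabilityMeasure P]
        (U : ℕ → Fin n → Ω → UnitSphere p), IsExploration P U →
      ∀ z₁ : Fin n → Euc p, (∀ i, z₁ i ∈ (1 - (powerParams c γ₀ r).ξ 1) • M.X) →
      ∀ x : ℕ → Fin n → Ω → Euc p,
        (∀ t i ω, x t i ω =
          M.xIter (powerParams c γ₀ r) z₁ (fun s j => U s j ω) t i) →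
      ∀ T : ℕ, 1 ≤ T →
        (∃ y ∈ M.feasibleSet T,
          ∑ t ∈ Finset.Icc 1 T, M.globalLoss t y = M.offlineOpt T) ∧
        Integrable (fun ω => M.netReg (fun t i => x t i ω) T) P ∧
        ∫ ω, M.netReg (fun t i => x t i ω) T ∂P ≤ C₁ * (T : ℝ) ^ max c (1 - c) ∧
        Integrable (fun ω => M.netCCV (fun t i => x t i ω) T) P ∧
        ∫ ω, M.netCCV (fun t i => x t i ω) T ∂P ≤ C₂ * (T : ℝ) ^ (1 - c) := by
  refine ⟨Problem.regretConst n p r R G₁ G₂ w B c γ₀, fun F ς hς =>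
    ⟨Problem.ccvConst n p r R G₁ G₂ w B c γ₀ F ς, ?_⟩⟩
  intro M _ hS hF hC hN hSl Ω _ P _ U hU z₁ hz₁ x hx T hT
  have H : M.Standing r R G₁ G₂ w B c γ₀ := ⟨hS, hC, hN, hn, hp, hr, hw, hB, hc, hγ₀, hγ₀'⟩
  obtain ⟨xs, hxs, hslater⟩ := hSl
  have hfeas : xs ∈ M.feasibleSet T := ⟨hxs, fun t ht k =>
    (hslater t (Finset.mem_Icc.1 ht).1 k).trans (by linarith)⟩
  obtain ⟨y, hy, hopt⟩ := H.exists_offlineOpt ⟨xs, hfeas⟩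
  have hxeq : ∀ ω, (fun t i => x t i ω) =
      M.xIter (powerParams c γ₀ r) z₁ (IsExploration.shifted U ω) := by
    intro ω
    funext t i
    rw [hx, M.xIter_congr (u' := IsExploration.shifted U ω) _ z₁
      fun s hs _ => (IsExploration.shifted_eq hs ω).symm]
  simp_rw [hxeq]
  have hregint : Integrable (fun ω => M.netReg
      (M.xIter (powerParams c γ₀ r) z₁ (IsExploration.shifted U ω)) T) P :=
    integrable_comp_of_continuous (H.continuous_netReg hz₁ T) hU.measurable_shifted
  have hccvint : Integrable (fun ω => M.netCCV
      (M.xIter (powerParams c γ₀ r) z₁ (IsExploration.shifted U ω)) T) P :=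
    integrable_comp_of_continuous (H.continuous_netCCV hz₁ T) hU.measurable_shifted
  have hnoise : ∀ v ∈ M.X, ∀ t ∈ Finset.Icc 1 T, ∀ i : Fin n, Integrable (fun ω =>
      M.noise (powerParams c γ₀ r) G₁ G₂ t i v
        (M.xIter (powerParams c γ₀ r) z₁ (IsExploration.shifted U ω) t i)
        (IsExploration.shifted U ω t i)) P := fun v hv t ht i =>
    integrable_comp_of_continuous (H.continuous_noise hz₁ (Finset.mem_Icc.1 ht).1 i hv)
      hU.measurable_shifted
  refine ⟨⟨y, hy, hopt⟩, hregint, ?_, hccvint, ?_⟩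
  -- The comparators, here the offline optimum and below the Slater point, are deterministic, as the
  -- bound on the mean noise requires.
  · refine integral_le_of_le_add_sum (a := fun _ _ => 1 / (n : ℝ)) hregint (hnoise y hy.1) (fun _ _ _ => by positivity)
      (fun t ht i => hU.integral_noise_nonpos H hz₁ (Finset.mem_Icc.1 ht).1 i hy.1) fun ω => ?_
    have := H.regret_path_le hz₁ (IsExploration.shifted U ω) hT hy
    rwa [hopt] at this
  · have hG₂ := H.G₂_nonneg
    have hCW := Problem.consensusConst_nonneg n w B
    refine integral_le_of_le_add_sum hccvint (hnoise xs hxs) (fun t ht _ => ?_)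
      (fun t ht i => hU.integral_noise_nonpos H hz₁ (Finset.mem_Icc.1 ht).1 i hxs) fun ω =>
        H.ccv_path_le hz₁ (IsExploration.shifted U ω) hT hF hς hxs hslater
    have := rate_pos (c := c) (Finset.mem_Icc.1 ht).1
    rw [Problem.violFactor]
    positivity
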